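/- Let $a<0<b$, let $k_0:(a,0)\to\mathbb R$ and $k_1:(0,b)\to\mathbb R$ be $C^\infty$ functions, each bounded below by a positive constant, and for $\varepsilon\in(0,1)$ put $k_\varepsilon=k_0$ on $(a,0)$ and $k_\varepsilon=\varepsilon^4k_1$ on $(0,b)$. A real number $\lambda$ is called an eigenvalue at $\varepsilon$ if there is a real function $u$, not identically zero, of class $C^4$ on $(a,0)\cup(0,b)$, such that $$(k_\varepsilon u'')''-\lambda u=0\quad\text{on }(a,0)\cup(0,b),\qquad u(a)=u'(a)=0,\qquad u(b)=u'(b)=0,$$ $$u(-0)=u(+0),\quad u'(-0)=u'(+0),\quad (k_0u'')(-0)=\varepsilon^4(k_1u'')(+0),\quad (k_0u'')'(-0)=\varepsilon^4(k_1u'')'(+0),$$ where all values at $a$, $\pm0$, $b$ are finite one-sided limits. Let $E\subset\mathbb R^2$ be the set of all pairs $(\varepsilon,\lambda)$ with $\varepsilon\in(0,1)$ and $\lambda$ an eigenvalue at $\varepsilon$. Then the closure of $E$ in $\mathbb R^2$ contains the half-line $\{(0,\lambda):\lambda\ge 0\}$. That is to say, for every $\lambda>0$ there are a sequence $\varepsilon_n\in(0,1)$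 with $\varepsilon_n\to0$ and eigenvalues $\lambda_n$ at $\varepsilon_n$ such that $\lambda_n\to\lambda$. -/

import Mathlib

open Set Filter Topology
open scoped ContDiff

/-- The stiffness coefficient `k_ε`: equal to `k₀` for `x < 0` and to `ε⁴ k₁` for `x > 0`.
(The value at the single point `x = 0` is never used.) -/
noncomputable def stiffness (k₀ k₁ : ℝ → ℝ) (ε : ℝ) (x : ℝ) : ℝ :=
  if x < 0 then k₀ x else ε ^ 4 * k₁ x

/-- The bending moment `k_ε u''`. -/
noncomputable def moment (k₀ k₁ : ℝ → ℝ) (ε : ℝ) (u : ℝ → ℝ) (x : ℝ) : ℝ :=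
  stiffness k₀ k₁ ε x * deriv (deriv u) x

/-- The one-sided limits of `f` at `0` from the left and from the right exist, are finite,
and agree: `f(-0) = f(+0)`. -/
def MatchesAtZero (f : ℝ → ℝ) : Prop :=
  ∃ m : ℝ, Tendsto f (𝓝[<] 0) (𝓝 m) ∧ Tendsto f (𝓝[>] 0) (𝓝 m)

/-- `u` is a classical solution of the stiff problem on `(a, b)` with parameters `ε` and `lam`.
Values and derivatives at the points `a`, `-0`, `+0`, `b` are understood as one-sided limits;
only the values of `u` on `(a, 0) ∪ (0, b)` matter. -/
structure IsStiffSolution (a b : ℝ) (k₀ k₁ : ℝ → ℝ) (ε lam : ℝ) (u : ℝ → ℝ) : Prop where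
  regular : ContDiffOn ℝ 4 u (Ioo a 0 ∪ Ioo 0 b)
  /-- the equation `(k_ε u'')'' - lam u = 0` -/
  equation : ∀ x ∈ Ioo a 0 ∪ Ioo 0 b,
    deriv (deriv (moment k₀ k₁ ε u)) x - lam * u x = 0
  /-- the boundary conditions `u(a) = u'(a) = 0` -/
  left_value : Tendsto u (𝓝[>] a) (𝓝 0)
  left_deriv : Tendsto (deriv u) (𝓝[>] a) (𝓝 0)
  /-- the boundary conditions `u(b) = u'(b) = 0` -/
  right_value : Tendsto u (𝓝[<] b) (𝓝 0)
  right_deriv : Tendsto (deriv u) (𝓝[<] b) (𝓝 0)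
  /-- `u(-0) = u(+0)` and `u'(-0) = u'(+0)` -/
  match_value : MatchesAtZero u
  match_deriv : MatchesAtZero (deriv u)
  /-- `(k₀ u'')(-0) = ε⁴ (k₁ u'')(+0)` and `(k₀ u'')'(-0) = ε⁴ (k₁ u'')'(+0)` -/
  match_moment : MatchesAtZero (moment k₀ k₁ ε u)
  match_moment_deriv : MatchesAtZero (deriv (moment k₀ k₁ ε u))

/-- `lam` is an eigenvalue of the stiff problem at `ε`: there is a solution which is not
identically zero on `(a, 0) ∪ (0, b)`. -/
def IsStiffEigenvalue (a b : ℝ) (k₀ k₁ : ℝ → ℝ) (ε lam : ℝ) : Prop :=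
  ∃ u : ℝ → ℝ, IsStiffSolution a b k₀ k₁ ε lam u ∧ ∃ x ∈ Ioo a 0 ∪ Ioo 0 b, u x ≠ 0

/-- The set `E` of all pairs `(ε, lam)` with `ε ∈ (0, 1)` and `lam` an eigenvalue at `ε`. -/
def stiffSpectrumSet (a b : ℝ) (k₀ k₁ : ℝ → ℝ) : Set (ℝ × ℝ) :=
  {p | p.1 ∈ Ioo (0 : ℝ) 1 ∧ IsStiffEigenvalue a b k₀ k₁ p.1 p.2}

/-! For fixed ε the problem is self-adjoint with a compact inverse `G` on L²(a, b). For such a `G`,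
a vector f with ‖f - lam G f‖ < δ‖G f‖ forces an eigenvalue μ of `G` with |μ⁻¹ - lam| < δ
(`exists_eigenvector_inv_near`). So it suffices to find a quasimode: a function w for which (k_ε
w'')'' - lam w is small relative to w in L².

On the soft side (0, b) the factor ε⁴ balances four derivatives of a wave of frequency ξ/ε. A fixed
bump χ near a point x₀, modulated by exp(iξx/ε), is therefore multiplied by ξ⁴k₁ up to O(ε)
(`exists_bound_planeWave_quasimode`). Every lam > 0 has the form ξ⁴k₁(x₀), and continuity of k₁
makes the remaining error small once χ is narrow. Since χ has compact support in (0, b), all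
boundary and transmission conditions hold trivially, and k₀ does not enter the quasimode.

The inverse is explicit (`exists_green_operator`): with r = k_ε^(-1/2) and `K` the twofold
integration of r f from a, it is `K P K*`, where `P` encodes the clamped conditions at b. Its
eigenvectors satisfy an integral equation, whose solutions are classical
(`isStiffEigenvalue_of_integral_equation`). -/

/-! ### Approximate eigenvectors of compact symmetric operators -/

/-- A compact symmetric operator with an approximate solution of `f = lam • G f` has an eigenvector
whose inverse eigenvalue is close to `lam`. -/
theorem exists_eigenvector_inv_near {H : Type*} [NormedAddCommGroup H] [InnerProductSpace ℝ H]
    [CompleteSpace H] (G : H →L[ℝ] H) (hc : IsCompactOperator G)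
    (hs : (G : H →ₗ[ℝ] H).IsSymmetric) {lam δ : ℝ} (hδ : 0 < δ) (f : H)
    (hf : ‖f - lam • G f‖ < δ * ‖G f‖) :
    ∃ μ : ℝ, μ ≠ 0 ∧ |μ⁻¹ - lam| < δ ∧ ∃ u : H, u ≠ 0 ∧ G u = μ • u := by
  by_contra! hno
  refine absurd hf (not_lt.2 ?_)
  -- The inequality is a closed condition and the eigenspaces span a dense subspace, so finite sums
  -- of eigenvectors suffice. By orthogonality the claim splits into δ|μ| ≤ |1 - lam μ|: trivial for
  -- μ = 0, and otherwise the negated conclusion multiplied by |μ|.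
  have hcl : IsClosed {f : H | δ * ‖G f‖ ≤ ‖f - lam • G f‖} :=
    isClosed_le (by fun_prop) (by fun_prop)
  have hbot := LinearMap.IsSymmetric.orthogonalFamily_eigenspaces hs
  have hd : Dense ((⨆ μ, Module.End.eigenspace (G : H →ₗ[ℝ] H) μ : Submodule ℝ H) : Set H) := by
    rw [Submodule.dense_iff_topologicalClosure_eq_top, Submodule.topologicalClosure_eq_top_iff]
    exact ContinuousLinearMap.orthogonalComplement_iSup_eigenspaces_eq_bot hc hs
  have hsub : ((⨆ μ, Module.End.eigenspace (G : H →ₗ[ℝ] H) μ : Submodule ℝ H) : Set H) ⊆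
      {f : H | δ * ‖G f‖ ≤ ‖f - lam • G f‖} := by
    intro x hx
    obtain ⟨c, hc1, rfl⟩ := (Submodule.mem_iSup_iff_exists_finsupp _ _).1 hx
    have hG : ∀ μ, G (c μ) = μ • c μ := fun μ => Module.End.mem_eigenspace_iff.1 (hc1 μ)
    set e : ∀ μ, Module.End.eigenspace (G : H →ₗ[ℝ] H) μ := fun μ => ⟨c μ, hc1 μ⟩
    have h1 : ‖G (c.sum fun _ x => x)‖ ^ 2 = ∑ μ ∈ c.support, ‖μ • e μ‖ ^ 2 := by
      rw [← hbot.norm_sum, Finsupp.sum, map_sum]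
      congr 2
      exact Finset.sum_congr rfl fun μ _ => by simp [hG, e]
    have h2 : ‖(c.sum fun _ x => x) - lam • G (c.sum fun _ x => x)‖ ^ 2
        = ∑ μ ∈ c.support, ‖(1 - lam * μ) • e μ‖ ^ 2 := by
      rw [← hbot.norm_sum, Finsupp.sum, map_sum, Finset.smul_sum, ← Finset.sum_sub_distrib]
      congr 2
      exact Finset.sum_congr rfl fun μ _ => by simp [hG, e, sub_smul, mul_smul]
    refine abs_le_of_sq_le_sq' ?_ (norm_nonneg _) |>.2
    rw [mul_pow, h1, h2, Finset.mul_sum]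
    refine Finset.sum_le_sum fun μ _ => ?_
    rw [norm_smul, norm_smul, ← mul_pow, ← mul_assoc]
    refine pow_le_pow_left₀ (by positivity) ?_ 2
    by_cases h0 : c μ = 0
    · simp [e, h0]
    refine mul_le_mul_of_nonneg_right ?_ (norm_nonneg _)
    rcases eq_or_ne μ 0 with rfl | hμ
    · simp
    have h3 : δ ≤ |μ⁻¹ - lam| := by
      by_contra! h
      exact hno μ hμ h (c μ) h0 (hG μ)
    calc δ * ‖μ‖ ≤ |μ⁻¹ - lam| * |μ| := mul_le_mul_of_nonneg_right h3 (abs_nonneg _)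
      _ = ‖1 - lam * μ‖ := by rw [← abs_mul, Real.norm_eq_abs]; congr 1; field_simp
  exact (hcl.closure_subset_iff.2 hsub) (hd f)

/-! ### Twofold integration as a compact operator on L² -/

open MeasureTheory in
/-- The Hilbert space `L²(a, b)`. -/
noncomputable abbrev L2Interval (a b : ℝ) := Lp ℝ 2 (volume.restrict (Ioc a b))

/-- The operator `f ↦ (x ↦ ⟪κ x, f⟫)` into continuous functions. -/
noncomputable def innerCurve {X H : Type*} [TopologicalSpace X] [CompactSpace X]
    [NormedAddCommGroup H] [InnerProductSpace ℝ H] (κ : C(X, H)) : H →L[ℝ] C(X, ℝ) :=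
  LinearMap.mkContinuous
    { toFun := fun f => ⟨fun x => inner ℝ (κ x) f, by fun_prop⟩
      map_add' := fun f g => by ext x; simp [inner_add_right]
      map_smul' := fun c f => by ext x; simp [inner_smul_right] } ‖κ‖
    (fun f => by
      rw [ContinuousMap.norm_le _ (by positivity)]
      intro x
      exact (norm_inner_le_norm _ _).trans
        (mul_le_mul_of_nonneg_right (κ.norm_coe_le_norm x) (norm_nonneg _)))

theorem innerCurve_apply {X H : Type*} [TopologicalSpace X] [CompactSpace X]
    [NormedAddCommGroup H] [InnerProductSpace ℝ H] (κ : C(X, H)) (f : H) (x : X) :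
    innerCurve κ f x = inner ℝ (κ x) f := rfl

/-- By Cauchy–Schwarz the image of the unit ball is bounded by ‖κ‖ and inherits equicontinuity from
the continuity of κ, so Arzelà–Ascoli applies. -/
theorem isCompactOperator_innerCurve {X H : Type*} [TopologicalSpace X] [CompactSpace X]
    [NormedAddCommGroup H] [InnerProductSpace ℝ H] (κ : C(X, H)) :
    IsCompactOperator (innerCurve κ) := by
  refine (isCompactOperator_iff_isCompact_closure_image_closedBall
    (innerCurve κ : H →ₗ[ℝ] C(X, ℝ)) one_pos).2 ?_
  set S : Set C(X, ℝ) := (innerCurve κ) '' Metric.closedBall 0 1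
  have key : IsCompact (closure (ContinuousMap.isometryEquivBoundedOfCompact X ℝ '' S)) := by
    refine BoundedContinuousFunction.arzela_ascoli (Metric.closedBall 0 ‖κ‖)
      (isCompact_closedBall _ _) _ ?_ ?_
    · rintro _ x ⟨_, ⟨f, hf, rfl⟩, rfl⟩
      rw [mem_closedBall_zero_iff] at hf ⊢
      refine (norm_inner_le_norm (κ x) f).trans ?_
      exact (mul_le_mul (κ.norm_coe_le_norm x) hf (norm_nonneg _) (norm_nonneg _)).trans
        (mul_one _).le
    · intro x
      rw [Metric.equicontinuousAt_iff_right]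
      intro ε hε
      filter_upwards [Metric.tendsto_nhds.1 (κ.continuous.tendsto x) ε hε] with y hy
      rintro ⟨_, ⟨_, ⟨f, hf, rfl⟩, rfl⟩⟩
      rw [mem_closedBall_zero_iff] at hf
      change dist (inner ℝ (κ x) f) (inner ℝ (κ y) f) < ε
      rw [dist_comm, Real.dist_eq, ← inner_sub_left]
      rw [dist_eq_norm] at hy
      calc |inner ℝ (κ y - κ x) f| ≤ ‖κ y - κ x‖ * ‖f‖ := abs_real_inner_le_norm _ _
        _ ≤ ‖κ y - κ x‖ * 1 := by gcongr
        _ < ε := by rwa [mul_one]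
  rw [← IsometryEquiv.coe_toHomeomorph, ← Homeomorph.image_closure] at key
  exact (Homeomorph.isCompact_image _).1 key

/-- Constant extension of continuous functions from `[a, b]` to the line. -/
noncomputable def extendInterval {a b : ℝ} (hab : a ≤ b) :
    C(Icc a b, ℝ) →L[ℝ] BoundedContinuousFunction ℝ ℝ :=
  LinearMap.mkContinuous
    { toFun := fun f => BoundedContinuousFunction.compContinuous
          (BoundedContinuousFunction.mkOfCompact f) ⟨projIcc a b hab, continuous_projIcc⟩
      map_add' := fun f g => by ext; rfl
      map_smul' := fun c f => by ext; rfl } 1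
    (fun f => by
      rw [BoundedContinuousFunction.norm_le (by positivity), one_mul]
      exact fun x => f.norm_coe_le_norm _)

open MeasureTheory in
/-- Continuous functions on `[a, b]` as elements of `L²(a, b)`. -/
noncomputable def toL2Interval {a b : ℝ} (hab : a ≤ b) : C(Icc a b, ℝ) →L[ℝ] L2Interval a b :=
  (BoundedContinuousFunction.toLp (E := ℝ) 2 (volume.restrict (Ioc a b)) ℝ).comp
    (extendInterval hab)

open MeasureTheory in
theorem coeFn_toL2Interval {a b : ℝ} (hab : a ≤ b) (f : C(Icc a b, ℝ)) :
    toL2Interval hab f =ᵐ[volume.restrict (Ioc a b)] fun x => f (projIcc a b hab x) := by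
  have h := BoundedContinuousFunction.coeFn_toLp (𝕜 := ℝ) (p := 2)
    (volume.restrict (Ioc a b)) (extendInterval hab f)
  exact h

open MeasureTheory in
theorem memLp_of_bound {a b : ℝ} {g : ℝ → ℝ} (hg : Measurable g) {C : ℝ}
    (hC : ∀ t ∈ Ioc a b, |g t| ≤ C) : MemLp g 2 (volume.restrict (Ioc a b)) :=
  MemLp.of_bound hg.aestronglyMeasurable C (ae_restrict_of_forall_mem measurableSet_Ioc hC)

open MeasureTheory in
/-- The operator with kernel `(x - t)₊ r(t)`, i.e. twofold integration from `a` of `r f`. It is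
compact, and its adjoint has the transposed kernel. -/
theorem exists_doubleIntegral_operator {a b : ℝ} (hab : a ≤ b) {r : ℝ → ℝ} (hr : Measurable r)
    {C : ℝ} (hC : ∀ t, |r t| ≤ C) : ∃ K : L2Interval a b →L[ℝ] L2Interval a b,
      IsCompactOperator K ∧
      (∀ f : L2Interval a b, K f =ᵐ[volume.restrict (Ioc a b)]
        fun x => ∫ t in Ioc a b, max (x - t) 0 * r t * f t) ∧
      ∀ f : L2Interval a b, ContinuousLinearMap.adjoint K f =ᵐ[volume.restrict (Ioc a b)]
        fun t => r t * ∫ x in Ioc a b, max (x - t) 0 * f x := by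
  have hC0 : 0 ≤ C := (abs_nonneg _).trans (hC 0)
  have hmem : ∀ x : Icc a b, MemLp (fun t => max ((x : ℝ) - t) 0 * r t) 2
      (volume.restrict (Ioc a b)) := fun x => by
    refine memLp_of_bound (by fun_prop) (C := (b - a) * C) fun t ht => ?_
    rw [abs_mul]
    refine mul_le_mul ?_ (hC t) (abs_nonneg _) (by linarith)
    rw [abs_of_nonneg (le_max_right _ _)]
    exact max_le (by linarith [ht.1, x.2.2]) (by linarith)
  have hcont : Continuous fun x : Icc a b => (hmem x).toLp := by
    -- The kernel sections at x and y differ pointwise by at most C|x - y|; the other factor in the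
    -- Lipschitz constant is the square root of the length of the interval.
    refine LipschitzWith.continuous (K := (((volume.restrict (Ioc a b) univ).toNNReal
      ^ (2 : ENNReal).toReal⁻¹) * C.toNNReal : NNReal)) (LipschitzWith.of_dist_le_mul fun x y => ?_)
    rw [dist_eq_norm, ← MemLp.toLp_sub]
    refine (Lp.norm_le_of_ae_bound (C := C * dist x y) (by positivity) ?_).trans ?_
    · filter_upwards [MemLp.coeFn_toLp ((hmem x).sub (hmem y))] with t ht
      rw [ht, Pi.sub_apply, ← sub_mul, norm_mul, mul_comm]
      refine mul_le_mul (hC t) ?_ (abs_nonneg _) hC0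
      refine (abs_max_sub_max_le_abs _ _ _).trans ?_
      rw [sub_sub_sub_cancel_right]; rfl
    · apply le_of_eq
      rw [NNReal.coe_mul, Real.coe_toNNReal _ hC0, mul_assoc, NNReal.coe_rpow]
      rfl
  set κ : C(Icc a b, L2Interval a b) := ⟨_, hcont⟩
  have hK : ∀ f : L2Interval a b, (toL2Interval hab).comp (innerCurve κ) f
      =ᵐ[volume.restrict (Ioc a b)] fun x => ∫ t in Ioc a b, max (x - t) 0 * r t * f t := by
    intro f
    filter_upwards [coeFn_toL2Interval hab (innerCurve κ f), ae_restrict_mem measurableSet_Ioc]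
      with x hx hxm
    have hxm' : x ∈ Icc a b := Ioc_subset_Icc_self hxm
    rw [ContinuousLinearMap.comp_apply, hx, innerCurve_apply, L2.inner_def]
    refine integral_congr_ae ?_
    filter_upwards [MemLp.coeFn_toLp (hmem (projIcc a b hab x))] with t ht
    simp only [κ, ContinuousMap.coe_mk]
    rw [ht, projIcc_of_mem hab hxm']
    simp [mul_comm]
  refine ⟨(toL2Interval hab).comp (innerCurve κ),
    (isCompactOperator_innerCurve κ).clm_comp (toL2Interval hab), hK, fun f => ?_⟩
  have hi : ∀ f : L2Interval a b, Integrable f (volume.restrict (Ioc a b)) := fun f =>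
    (Lp.memLp f).integrable (by norm_num)
  have hswap : ∀ h : L2Interval a b, Integrable (Function.uncurry fun x t : ℝ =>
      (max (x - t) 0 * r t) * (f x * h t))
      ((volume.restrict (Ioc a b)).prod (volume.restrict (Ioc a b))) := by
    intro h
    refine Integrable.bdd_mul ((hi f).mul_prod (hi h)) (c := (b - a) * C) ?_ ?_
    · exact (Measurable.aestronglyMeasurable (by fun_prop))
    · rw [Measure.prod_restrict]
      filter_upwards [ae_restrict_mem (measurableSet_Ioc.prod measurableSet_Ioc)] with p hp
      rw [norm_mul]
      refine mul_le_mul ?_ (hC _) (abs_nonneg _) (by linarith)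
      rw [Real.norm_of_nonneg (le_max_right _ _)]
      exact max_le (by linarith [hp.1.2, hp.2.1]) (by linarith)
  have hg : MemLp (fun t => r t * ∫ x in Ioc a b, max (x - t) 0 * f x) 2
      (volume.restrict (Ioc a b)) := by
    have hm : StronglyMeasurable fun t => ∫ x in Ioc a b, max (x - t) 0 * f x :=
      StronglyMeasurable.integral_prod_right' (f := fun p : ℝ × ℝ => max (p.2 - p.1) 0 * f p.2)
        ((by fun_prop : Measurable fun p : ℝ × ℝ => max (p.2 - p.1) 0).stronglyMeasurable.mul
          ((Lp.stronglyMeasurable f).comp_measurable measurable_snd))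
    refine memLp_of_bound (hr.mul hm.measurable)
      (C := C * ∫ x in Ioc a b, (b - a) * |f x|) fun t ht => ?_
    rw [abs_mul]
    refine mul_le_mul (hC t) ?_ (abs_nonneg _) hC0
    rw [← Real.norm_eq_abs (∫ x in Ioc a b, _)]
    refine norm_integral_le_of_norm_le ((hi f).abs.const_mul _) ?_
    filter_upwards [ae_restrict_mem measurableSet_Ioc] with x hx
    rw [norm_mul, Real.norm_of_nonneg (le_max_right _ _)]
    exact mul_le_mul_of_nonneg_right (max_le (by linarith [hx.2, ht.1]) (by linarith))
      (norm_nonneg _)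
  -- The adjoint is identified by pairing with an arbitrary h and exchanging the integrals.
  have : ContinuousLinearMap.adjoint ((toL2Interval hab).comp (innerCurve κ)) f = hg.toLp := by
    refine ext_inner_right ℝ fun h => ?_
    rw [ContinuousLinearMap.adjoint_inner_left, L2.inner_def, L2.inner_def]
    have e1 : ∫ x in Ioc a b, inner ℝ (f x) ((toL2Interval hab).comp (innerCurve κ) h x) =
        ∫ x in Ioc a b, ∫ t in Ioc a b, (max (x - t) 0 * r t) * (f x * h t) := by
      refine integral_congr_ae ?_
      filter_upwards [hK h] with x hx
      rw [hx, Real.inner_apply, ← integral_const_mul]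
      exact integral_congr_ae (ae_of_all _ fun t => by ring)
    have e2 : ∫ t in Ioc a b, inner ℝ ((hg.toLp : L2Interval a b) t) (h t) =
        ∫ t in Ioc a b, ∫ x in Ioc a b, (max (x - t) 0 * r t) * (f x * h t) := by
      refine integral_congr_ae ?_
      filter_upwards [hg.coeFn_toLp] with t ht
      rw [ht, Real.inner_apply, mul_comm, ← mul_assoc, ← integral_const_mul]
      exact integral_congr_ae (ae_of_all _ fun x => by ring)
    rw [e1, e2, integral_integral_swap (hswap h)]
  rw [this]
  exact hg.coeFn_toLp

open MeasureTheory in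
/-- The twofold primitive of `g` on `(a, b)` vanishing to second order at `a`. -/
noncomputable def doublePrimitive (a b : ℝ) (g : ℝ → ℝ) (x : ℝ) : ℝ :=
  ∫ t in Ioc a b, max (x - t) 0 * g t

open MeasureTheory in
/-- The primitive of `g` on `(a, b)` vanishing at `a`. -/
noncomputable def primitive (a b : ℝ) (g : ℝ → ℝ) (x : ℝ) : ℝ :=
  ∫ t in a..x, (Ioc a b).indicator g t

/-! ### Primitives, double primitives and clamped functions -/

section Calculus

open MeasureTheory

variable {a b : ℝ} {g : ℝ → ℝ}

theorem intervalIntegrable_indicator (hg : IntegrableOn g (Ioc a b)) (x y : ℝ) :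
    IntervalIntegrable ((Ioc a b).indicator g) volume x y :=
  ((integrable_indicator_iff measurableSet_Ioc).2 hg).intervalIntegrable

theorem continuous_primitive (hg : IntegrableOn g (Ioc a b)) : Continuous (primitive a b g) :=
  intervalIntegral.continuous_primitive (fun x y => intervalIntegrable_indicator hg x y) a

theorem primitive_left : primitive a b g a = 0 := by simp [primitive]

theorem primitive_right (hab : a ≤ b) : primitive a b g b = ∫ t in Ioc a b, g t := by
  rw [primitive, intervalIntegral.integral_of_le hab, setIntegral_indicator measurableSet_Ioc,
    inter_self]

/-- The indicator of t < x is the x-derivative of (x - t)₊; this is the form in which the derivative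
of a double primitive appears. -/
theorem setIntegral_Iio_indicator (x : ℝ) :
    ∫ t in Ioc a b, (Iio x).indicator g t = primitive a b g x := by
  rw [primitive, setIntegral_indicator measurableSet_Iio]
  rcases le_total a x with h | h
  · rw [intervalIntegral.integral_of_le h, setIntegral_indicator measurableSet_Ioc]
    refine setIntegral_congr_set ?_
    have e : Ioc a x ∩ Ioc a b = Ioc a b ∩ Iic x := by
      ext t
      simp only [mem_inter_iff, mem_Ioc, mem_Iic]
      tauto
    rw [e]
    exact (ae_eq_refl _).inter Iio_ae_eq_Iic
  · rw [intervalIntegral.integral_of_ge h, setIntegral_indicator measurableSet_Ioc,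
      show Ioc a b ∩ Iio x = ∅ by ext t; simp; grind,
      show Ioc x a ∩ Ioc a b = ∅ by ext t; simp; grind]
    simp

/-- The kernel (x - t)₊ is 1-Lipschitz in x and differentiable there except when t = x, a null set,
so integrability of g alone permits differentiation under the integral. -/
theorem hasDerivAt_doublePrimitive (hg : IntegrableOn g (Ioc a b)) (x : ℝ) :
    HasDerivAt (doublePrimitive a b g) (primitive a b g x) x := by
  rw [← setIntegral_Iio_indicator]
  have hint : ∀ y, Integrable (fun t => max (y - t) 0 * g t) (volume.restrict (Ioc a b)) := by
    intro y
    refine Integrable.bdd_mul hg (c := |y| + |a| + |b|)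
      (Measurable.aestronglyMeasurable (by fun_prop)) ?_
    filter_upwards [ae_restrict_mem measurableSet_Ioc] with t ht
    rw [Real.norm_of_nonneg (le_max_right _ _)]
    refine max_le ?_ (by positivity)
    linarith [le_abs_self y, neg_abs_le a, ht.1, abs_nonneg b]
  refine (hasDerivAt_integral_of_dominated_loc_of_lip (F := fun y t => max (y - t) 0 * g t)
    (bound := fun t => |g t|) (s := univ) (x₀ := x) univ_mem
    (Eventually.of_forall fun y => (hint y).aestronglyMeasurable) (hint x)
    (hg.aestronglyMeasurable.indicator measurableSet_Iio) ?_ hg.abs ?_).2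
  · refine ae_of_all _ fun t => LipschitzOnWith.of_dist_le_mul fun y _ z _ => ?_
    rw [Real.dist_eq, ← sub_mul, abs_mul, mul_comm, Real.coe_nnabs, abs_abs]
    refine mul_le_mul_of_nonneg_left ((abs_max_sub_max_le_abs _ _ _).trans ?_) (abs_nonneg _)
    rw [sub_sub_sub_cancel_right, Real.dist_eq]
  · have hne : ∀ᵐ t ∂(volume.restrict (Ioc a b)), t ≠ x :=
      ae_restrict_of_ae (compl_mem_ae_iff.2 (measure_singleton x))
    filter_upwards [hne] with t ht
    rcases lt_or_gt_of_ne ht with h | h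
    · rw [indicator_of_mem (by exact h)]
      have : HasDerivAt (fun y => (y - t) * g t) (1 * g t) x :=
        ((hasDerivAt_id x).sub_const t).mul_const (g t)
      rw [one_mul] at this
      refine this.congr_of_eventuallyEq ?_
      filter_upwards [lt_mem_nhds h] with y hy
      rw [max_eq_left (by linarith)]
    · rw [indicator_of_notMem (by simp [h.le])]
      refine (hasDerivAt_const x (0 : ℝ)).congr_of_eventuallyEq ?_
      filter_upwards [gt_mem_nhds h] with y hy
      rw [max_eq_right (by linarith), zero_mul]

theorem hasDerivAt_primitive (hg : IntegrableOn g (Ioc a b)) {x : ℝ} (hx : x ∈ Ioo a b)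
    (hc : ∀ᶠ y in 𝓝 x, ContinuousAt g y) : HasDerivAt (primitive a b g) (g x) x := by
  have heq : (Ioc a b).indicator g =ᶠ[𝓝 x] g := by
    filter_upwards [isOpen_Ioo.mem_nhds hx] with y hy
    exact indicator_of_mem (Ioo_subset_Ioc_self hy) g
  have h : HasDerivAt (primitive a b g) ((Ioc a b).indicator g x) x := by
    refine intervalIntegral.integral_hasDerivAt_right (intervalIntegrable_indicator hg a x) ?_ ?_
    · exact ⟨univ, univ_mem, ((integrable_indicator_iff measurableSet_Ioc).2
        hg).aestronglyMeasurable.restrict⟩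
    · exact hc.self_of_nhds.congr heq.symm
  rwa [heq.self_of_nhds] at h

theorem doublePrimitive_left : doublePrimitive a b g a = 0 := by
  refine setIntegral_eq_zero_of_forall_eq_zero fun t ht => ?_
  rw [max_eq_right (sub_nonpos.2 ht.1.le), zero_mul]

theorem doublePrimitive_right (hg : IntegrableOn g (Ioc a b))
    (hg' : IntegrableOn (fun t => t * g t) (Ioc a b)) :
    doublePrimitive a b g b = b * (∫ t in Ioc a b, g t) - ∫ t in Ioc a b, t * g t := by
  rw [doublePrimitive, ← integral_const_mul, ← integral_sub (hg.const_mul b) hg']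
  refine setIntegral_congr_fun measurableSet_Ioc fun t ht => ?_
  rw [max_eq_left (sub_nonneg.2 ht.2), sub_mul]

theorem integrableOn_id_mul (hg : IntegrableOn g (Ioc a b)) :
    IntegrableOn (fun t => t * g t) (Ioc a b) := by
  refine Integrable.bdd_mul hg (c := |a| + |b|) measurable_id.aestronglyMeasurable ?_
  filter_upwards [ae_restrict_mem measurableSet_Ioc] with t ht
  rw [Real.norm_eq_abs, abs_le]
  constructor <;> linarith [neg_abs_le a, le_abs_self b, ht.1, ht.2, abs_nonneg a, abs_nonneg b]

/-- Because (x - t)₊ - (t - x)₊ = x - t, the transposed kernel differs from the original one by a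
function affine in t. This turns the adjoint of twofold integration back into a double primitive. -/
theorem setIntegral_max_sub_mul (hg : IntegrableOn g (Ioc a b)) (t : ℝ) :
    ∫ x in Ioc a b, max (x - t) 0 * g x =
      doublePrimitive a b g t + (∫ x in Ioc a b, x * g x) - t * ∫ x in Ioc a b, g x := by
  have h1 : ∫ x in Ioc a b, (max (x - t) 0 * g x - max (t - x) 0 * g x) =
      ∫ x in Ioc a b, (x * g x - t * g x) := by
    refine integral_congr_ae (ae_of_all _ fun x => ?_)
    rcases le_total x t with h | h
    · simp only [max_eq_right (sub_nonpos.2 h), max_eq_left (sub_nonneg.2 h)]; ring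
    · simp only [max_eq_right (sub_nonpos.2 h), max_eq_left (sub_nonneg.2 h)]; ring
  have hi1 : IntegrableOn (fun x => max (t - x) 0 * g x) (Ioc a b) := by
    refine Integrable.bdd_mul hg (c := |t| + |a|)
      (Measurable.aestronglyMeasurable (by fun_prop)) ?_
    filter_upwards [ae_restrict_mem measurableSet_Ioc] with x hx
    rw [Real.norm_of_nonneg (le_max_right _ _)]
    refine max_le ?_ (by positivity)
    linarith [le_abs_self t, neg_abs_le a, hx.1]
  have hi2 : IntegrableOn (fun x => max (x - t) 0 * g x) (Ioc a b) := by
    refine Integrable.bdd_mul hg (c := |t| + |b|)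
      (Measurable.aestronglyMeasurable (by fun_prop)) ?_
    filter_upwards [ae_restrict_mem measurableSet_Ioc] with x hx
    rw [Real.norm_of_nonneg (le_max_right _ _)]
    refine max_le ?_ (by positivity)
    linarith [neg_abs_le t, le_abs_self b, hx.2]
  rw [integral_sub hi2 hi1, integral_sub (integrableOn_id_mul hg) (hg.const_mul t),
    integral_const_mul] at h1
  rw [doublePrimitive]
  linarith

/-- Taylor's formula with integral remainder; the part of the integral over t > x vanishes. -/
theorem doublePrimitive_deriv_deriv {w : ℝ → ℝ} (hw : ContDiff ℝ 2 w) (h0 : w a = 0)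
    (h1 : deriv w a = 0) {x : ℝ} (hx : x ∈ Icc a b) :
    doublePrimitive a b (deriv (deriv w)) x = w x := by
  have hd : ContDiff ℝ 1 (deriv w) := ((contDiff_succ_iff_deriv (n := 1)).1 hw).2.2
  have hc : Continuous (deriv (deriv w)) := ((contDiff_one_iff_deriv).1 hd).2
  have e : doublePrimitive a b (deriv (deriv w)) x
      = ∫ t in a..x, (x - t) * deriv (deriv w) t := by
    rw [intervalIntegral.integral_of_le hx.1, doublePrimitive,
      ← Ioc_union_Ioc_eq_Ioc hx.1 hx.2, setIntegral_union (by
        rw [Set.disjoint_left]; exact fun t ht ht' => absurd ht.2 (not_le.2 ht'.1))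
        measurableSet_Ioc
        ((by fun_prop : Continuous fun t => max (x - t) 0 * deriv (deriv w) t).integrableOn_Ioc)
        ((by fun_prop : Continuous fun t => max (x - t) 0 * deriv (deriv w) t).integrableOn_Ioc),
      setIntegral_congr_fun (g := 0) (s := Ioc x b) measurableSet_Ioc]
    · simp only [Pi.zero_apply, integral_zero, add_zero]
      refine setIntegral_congr_fun measurableSet_Ioc fun t ht => ?_
      simp only [max_eq_left (sub_nonneg.2 ht.2)]
    · intro t ht
      simp [max_eq_right (sub_nonpos.2 ht.1.le)]
  rw [e, intervalIntegral.integral_eq_sub_of_hasDerivAt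
    (f := fun t => (x - t) * deriv w t + w t)]
  · simp [h0, h1]
  · intro t _
    have hw1 := (hw.differentiable (by norm_num) t).hasDerivAt
    have hw2 := (hd.differentiable (by norm_num) t).hasDerivAt
    refine ((((hasDerivAt_id t).const_sub x).mul hw2).add hw1).congr_deriv ?_
    rw [id_eq]
    ring
  · exact (by fun_prop : Continuous fun t => (x - t) * deriv (deriv w) t).intervalIntegrable _ _

theorem setIntegral_deriv_deriv_eq_zero (hab : a ≤ b) {w : ℝ → ℝ} (hw : ContDiff ℝ 2 w)
    (h1 : deriv w a = 0) (h3 : deriv w b = 0) :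
    ∫ t in Ioc a b, deriv (deriv w) t = 0 := by
  have hd : ContDiff ℝ 1 (deriv w) := ((contDiff_succ_iff_deriv (n := 1)).1 hw).2.2
  have hc : Continuous (deriv (deriv w)) := ((contDiff_one_iff_deriv).1 hd).2
  rw [← intervalIntegral.integral_of_le hab, intervalIntegral.integral_deriv_eq_sub
    (fun t _ => hd.differentiable (by norm_num) t) (hc.intervalIntegrable _ _), h1, h3, sub_zero]

theorem setIntegral_id_mul_deriv_deriv_eq_zero (hab : a ≤ b) {w : ℝ → ℝ} (hw : ContDiff ℝ 2 w)
    (h0 : w a = 0) (h1 : deriv w a = 0) (h2 : w b = 0) (h3 : deriv w b = 0) :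
    ∫ t in Ioc a b, t * deriv (deriv w) t = 0 := by
  have hd : ContDiff ℝ 1 (deriv w) := ((contDiff_succ_iff_deriv (n := 1)).1 hw).2.2
  have hc : Continuous (deriv (deriv w)) := ((contDiff_one_iff_deriv).1 hd).2
  have h := doublePrimitive_right (a := a) (b := b) hc.integrableOn_Ioc
    (integrableOn_id_mul hc.integrableOn_Ioc)
  rw [doublePrimitive_deriv_deriv hw h0 h1 ⟨hab, le_rfl⟩,
    setIntegral_deriv_deriv_eq_zero hab hw h1 h3, h2] at h
  linarith

end Calculus

/-! ### The inverse of the clamped fourth-order operator -/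

section Green

open MeasureTheory

/-- Green's operator of `(r⁻² u'')''` with clamped ends. -/
theorem exists_green_operator {a b : ℝ} (hab : a ≤ b) {r : ℝ → ℝ} (hr : Measurable r)
    {C : ℝ} (hC : ∀ t, |r t| ≤ C) : ∃ G : L2Interval a b →L[ℝ] L2Interval a b,
      IsCompactOperator G ∧ (G : L2Interval a b →ₗ[ℝ] L2Interval a b).IsSymmetric ∧
      (∀ (μ : ℝ) (u : L2Interval a b), μ ≠ 0 → u ≠ 0 → G u = μ • u →
        ∃ (U M : ℝ → ℝ) (α β : ℝ), ¬ U =ᵐ[volume.restrict (Ioc a b)] 0 ∧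
          IntegrableOn U (Ioc a b) ∧ IntegrableOn (fun t => r t ^ 2 * M t) (Ioc a b) ∧
          (∀ t, M t = μ⁻¹ * doublePrimitive a b U t + α + β * t) ∧
          U = doublePrimitive a b (fun t => r t ^ 2 * M t) ∧
          ∫ t in Ioc a b, r t ^ 2 * M t = 0 ∧ ∫ t in Ioc a b, t * (r t ^ 2 * M t) = 0) ∧
      (∀ w m : ℝ → ℝ, ContDiff ℝ 2 w → ContDiff ℝ 2 m →
        w a = 0 → deriv w a = 0 → w b = 0 → deriv w b = 0 →
        m a = 0 → deriv m a = 0 → m b = 0 → deriv m b = 0 →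
        (∀ t ∈ Ioc a b, r t ^ 2 * m t = deriv (deriv w) t) →
        ∀ f : L2Interval a b, f =ᵐ[volume.restrict (Ioc a b)] deriv (deriv m) →
          G f =ᵐ[volume.restrict (Ioc a b)] w) := by
  obtain ⟨K, hKc, hK, hKa⟩ := exists_doubleIntegral_operator hab hr hC
  have hn1 : MemLp r 2 (volume.restrict (Ioc a b)) := memLp_of_bound hr fun t _ => hC t
  have hn2 : MemLp (fun t => t * r t) 2 (volume.restrict (Ioc a b)) := by
    refine memLp_of_bound (by fun_prop) (C := (|a| + |b|) * C) fun t ht => ?_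
    rw [abs_mul]
    refine mul_le_mul ?_ (hC t) (abs_nonneg _) (by positivity)
    rw [abs_le]
    constructor <;> linarith [neg_abs_le a, le_abs_self b, ht.1, ht.2, abs_nonneg a, abs_nonneg b]
  have hi : ∀ f : L2Interval a b, Integrable f (volume.restrict (Ioc a b)) := fun f =>
    (Lp.memLp f).integrable (by norm_num)
  -- Orthogonality to r and t r says exactly that the double primitive of r v vanishes at b together
  -- with its derivative.
  set N : Submodule ℝ (L2Interval a b) := Submodule.span ℝ {hn1.toLp, hn2.toLp} with hN
  have : FiniteDimensional ℝ N := FiniteDimensional.span_of_finite ℝ (by simp)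
  set P := Nᗮ.starProjection with hP
  have hort : ∀ v : L2Interval a b, v ∈ Nᗮ ↔ ∫ t in Ioc a b, r t * v t = 0 ∧
      ∫ t in Ioc a b, t * (r t * v t) = 0 := by
    intro v
    have e1 : inner ℝ (hn1.toLp : L2Interval a b) v = ∫ t in Ioc a b, r t * v t := by
      rw [L2.inner_def]
      refine integral_congr_ae ?_
      filter_upwards [hn1.coeFn_toLp] with t ht
      rw [ht, Real.inner_apply]
    have e2 : inner ℝ (hn2.toLp : L2Interval a b) v = ∫ t in Ioc a b, t * (r t * v t) := by
      rw [L2.inner_def]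
      refine integral_congr_ae ?_
      filter_upwards [hn2.coeFn_toLp] with t ht
      rw [ht, Real.inner_apply, mul_assoc]
    rw [Submodule.mem_orthogonal, ← e1, ← e2]
    constructor
    · exact fun h => ⟨h _ (Submodule.subset_span (by simp)), h _ (Submodule.subset_span (by simp))⟩
    · rintro ⟨h1, h2⟩ x hx
      obtain ⟨α, β, rfl⟩ := Submodule.mem_span_pair.1 hx
      rw [inner_add_left, inner_smul_left, inner_smul_left, h1, h2]
      simp
  refine ⟨K ∘L P ∘L ContinuousLinearMap.adjoint K, hKc.comp_clm _, ?_, ?_, ?_⟩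
  · intro x y
    change inner ℝ (K (P (ContinuousLinearMap.adjoint K x))) y =
      inner ℝ x (K (P (ContinuousLinearMap.adjoint K y)))
    rw [← ContinuousLinearMap.adjoint_inner_right K, ← ContinuousLinearMap.adjoint_inner_left K,
      hP, Submodule.inner_starProjection_left_eq_right]
  · intro μ u hμ hu hGu
    -- Here v plays the role of r⁻¹u'', that is, r times the bending moment: K v = u recovers u, and
    -- v differs from μ⁻¹ K* u by an element of N.
    set v : L2Interval a b := μ⁻¹ • P (ContinuousLinearMap.adjoint K u) with hv
    have hKv : K v = u := by
      rw [hv, map_smul]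
      change μ⁻¹ • (K ∘L P ∘L ContinuousLinearMap.adjoint K) u = u
      rw [hGu, inv_smul_smul₀ hμ]
    have hvN : v ∈ Nᗮ := Nᗮ.smul_mem _ (Nᗮ.starProjection_apply_mem _)
    have hsub : v - μ⁻¹ • ContinuousLinearMap.adjoint K u ∈ N := by
      rw [hv, ← smul_sub]
      refine N.smul_mem _ ?_
      rw [← neg_sub]
      refine N.neg_mem ?_
      have := Nᗮ.sub_starProjection_mem_orthogonal (ContinuousLinearMap.adjoint K u)
      rwa [Submodule.orthogonal_orthogonal] at this
    obtain ⟨α, β, hαβ⟩ := Submodule.mem_span_pair.1 hsub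
    obtain ⟨h1, h2⟩ := (hort v).1 hvN
    -- The affine part collects the terms from transposing the kernel and the coefficients of the
    -- N-component.
    set M : ℝ → ℝ := fun t => μ⁻¹ * doublePrimitive a b u t
      + (μ⁻¹ * (∫ x in Ioc a b, x * u x) + α) + (β - μ⁻¹ * ∫ x in Ioc a b, u x) * t with hM
    have hvM : v =ᵐ[volume.restrict (Ioc a b)] fun t => r t * M t := by
      have : v = α • hn1.toLp + β • hn2.toLp + μ⁻¹ • ContinuousLinearMap.adjoint K u := by
        rw [hαβ, sub_add_cancel]
      rw [this]
      filter_upwards [Lp.coeFn_add (α • hn1.toLp + β • hn2.toLp : L2Interval a b)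
        (μ⁻¹ • ContinuousLinearMap.adjoint K u),
        Lp.coeFn_add (α • hn1.toLp : L2Interval a b) (β • hn2.toLp),
        Lp.coeFn_smul α (hn1.toLp : L2Interval a b), Lp.coeFn_smul β (hn2.toLp : L2Interval a b),
        Lp.coeFn_smul μ⁻¹ (ContinuousLinearMap.adjoint K u), hn1.coeFn_toLp, hn2.coeFn_toLp,
        hKa u] with t t1 t2 t3 t4 t5 t6 t7 t8
      rw [t1, Pi.add_apply, t2, Pi.add_apply, t3, t4, t5, Pi.smul_apply, Pi.smul_apply,
        Pi.smul_apply, t6, t7, t8, setIntegral_max_sub_mul (hi u)]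
      simp only [smul_eq_mul, hM]
      ring
    have hrv : (fun t => r t * v t) =ᵐ[volume.restrict (Ioc a b)] fun t => r t ^ 2 * M t := by
      filter_upwards [hvM] with t ht
      rw [ht]; ring
    have huU : u =ᵐ[volume.restrict (Ioc a b)]
        doublePrimitive a b (fun t => r t ^ 2 * M t) := by
      have := hK v
      rw [hKv] at this
      filter_upwards [this] with x hx
      rw [hx]
      refine integral_congr_ae ?_
      filter_upwards [hrv] with t ht
      rw [← ht, mul_assoc]
    have hdp : doublePrimitive a b u
        = doublePrimitive a b (doublePrimitive a b (fun t => r t ^ 2 * M t)) := by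
      ext x
      refine integral_congr_ae ?_
      filter_upwards [huU] with t ht
      rw [ht]
    -- The class u is replaced by its representative that is a double primitive everywhere, so
    -- pointwise calculus applies to it.
    refine ⟨doublePrimitive a b (fun t => r t ^ 2 * M t), M, _, _, ?_, (hi u).congr huU, ?_,
      fun t => by rw [← hdp], rfl, ?_, ?_⟩
    · intro h0
      exact hu ((Lp.eq_zero_iff_ae_eq_zero).2 (huU.trans h0))
    · refine Integrable.congr ?_ hrv
      exact Integrable.bdd_mul (hi v) hr.aestronglyMeasurable (ae_of_all _ hC)
    · rw [← integral_congr_ae hrv, h1]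
    · rw [← h2]
      refine integral_congr_ae ?_
      filter_upwards [hrv] with t ht
      rw [ht]
  · intro w m hw hm wa wa' wb wb' ma ma' mb mb' hwm f hf
    have hfint : ∀ t, ∫ x in Ioc a b, max (x - t) 0 * f x =
        ∫ x in Ioc a b, max (x - t) 0 * deriv (deriv m) x := fun t => by
      refine integral_congr_ae ?_
      filter_upwards [hf] with x hx
      rw [hx]
    have hmi : IntegrableOn (deriv (deriv m)) (Ioc a b) := (hi f).congr hf
    -- Since m is clamped at both ends, the affine terms vanish and K* f = r m. Hence r v = w'', the
    -- clamped conditions on w put v in the range of P, and K v = w.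
    set v : L2Interval a b := ContinuousLinearMap.adjoint K f with hv
    have hrv : (fun t => r t * v t) =ᵐ[volume.restrict (Ioc a b)] deriv (deriv w) := by
      filter_upwards [hKa f, ae_restrict_mem measurableSet_Ioc] with t ht htm
      rw [ht, hfint, setIntegral_max_sub_mul hmi,
        doublePrimitive_deriv_deriv hm ma ma' (Ioc_subset_Icc_self htm),
        setIntegral_deriv_deriv_eq_zero hab hm ma' mb',
        setIntegral_id_mul_deriv_deriv_eq_zero hab hm ma ma' mb mb', ← hwm t htm]
      ring
    have hvN : v ∈ Nᗮ := by
      rw [hort]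
      constructor
      · rw [integral_congr_ae hrv, setIntegral_deriv_deriv_eq_zero hab hw wa' wb']
      · rw [← setIntegral_id_mul_deriv_deriv_eq_zero hab hw wa wa' wb wb']
        refine integral_congr_ae ?_
        filter_upwards [hrv] with t ht
        rw [ht]
    have : (K ∘L P ∘L ContinuousLinearMap.adjoint K) f = K v := by
      change K (P v) = K v
      rw [hP, Submodule.starProjection_eq_self_iff.2 hvN]
    rw [this]
    filter_upwards [hK v, ae_restrict_mem measurableSet_Ioc] with x hx hxm
    rw [hx, ← doublePrimitive_deriv_deriv hw wa wa' (Ioc_subset_Icc_self hxm)]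
    refine integral_congr_ae ?_
    filter_upwards [hrv] with t ht
    rw [← ht, mul_assoc]

end Green

/-! ### From the integral equation to classical eigenfunctions -/

/-- The function `stiffness ^ (-1/2)` on `(a, 0) ∪ (0, b)`, extended by zero. -/
noncomputable def stiffWeight (a b : ℝ) (k₀ k₁ : ℝ → ℝ) (ε : ℝ) : ℝ → ℝ :=
  (Ioo a 0 ∪ Ioo 0 b).indicator fun t => (√(stiffness k₀ k₁ ε t))⁻¹

section Stiff

open MeasureTheory

variable {a b : ℝ} {k₀ k₁ : ℝ → ℝ} {ε : ℝ}

theorem contDiffOn_stiffness (hk₀ : ContDiffOn ℝ ∞ k₀ (Ioo a 0)) (hk₁ : ContDiffOn ℝ ∞ k₁ (Ioo 0 b)) :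
    ContDiffOn ℝ ∞ (stiffness k₀ k₁ ε) (Ioo a 0 ∪ Ioo 0 b) := by
  refine ContDiffOn.union_of_isOpen ?_ ?_ isOpen_Ioo isOpen_Ioo
  · exact hk₀.congr fun x hx => by simp [stiffness, hx.2]
  · exact ((contDiffOn_const (c := ε ^ 4)).mul hk₁).congr fun x hx => by
      rw [stiffness, if_neg (not_lt.2 hx.1.le)]

theorem exists_pos_le_stiffness (hε : 0 < ε) (hpos₀ : ∃ c > 0, ∀ x ∈ Ioo a 0, c ≤ k₀ x)
    (hpos₁ : ∃ c > 0, ∀ x ∈ Ioo 0 b, c ≤ k₁ x) :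
    ∃ c > 0, ∀ x ∈ Ioo a 0 ∪ Ioo 0 b, c ≤ stiffness k₀ k₁ ε x := by
  obtain ⟨c₀, hc₀, h₀⟩ := hpos₀
  obtain ⟨c₁, hc₁, h₁⟩ := hpos₁
  refine ⟨min c₀ (ε ^ 4 * c₁), by positivity, ?_⟩
  rintro x (hx | hx)
  · rw [stiffness, if_pos hx.2]
    exact (min_le_left _ _).trans (h₀ x hx)
  · rw [stiffness, if_neg (not_lt.2 hx.1.le)]
    exact (min_le_right _ _).trans (mul_le_mul_of_nonneg_left (h₁ x hx) (by positivity))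

theorem stiffWeight_sq {t : ℝ} (ht : t ∈ Ioo a 0 ∪ Ioo 0 b) (h : 0 < stiffness k₀ k₁ ε t) :
    stiffWeight a b k₀ k₁ ε t ^ 2 = (stiffness k₀ k₁ ε t)⁻¹ := by
  rw [stiffWeight, indicator_of_mem ht, inv_pow, Real.sq_sqrt h.le]

theorem measurable_stiffWeight
    (hs : ContinuousOn (stiffness k₀ k₁ ε) (Ioo a 0 ∪ Ioo 0 b))
    (hpos : ∀ x ∈ Ioo a 0 ∪ Ioo 0 b, 0 < stiffness k₀ k₁ ε x) :
    Measurable (stiffWeight a b k₀ k₁ ε) := by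
  classical
  rw [stiffWeight, ← piecewise_eq_indicator]
  refine ContinuousOn.measurable_piecewise ?_ continuousOn_const
    (isOpen_Ioo.union isOpen_Ioo).measurableSet
  exact (hs.sqrt).inv₀ fun x hx => (Real.sqrt_pos.2 (hpos x hx)).ne'

theorem exists_bound_stiffWeight (h : ∃ c > 0, ∀ x ∈ Ioo a 0 ∪ Ioo 0 b, c ≤ stiffness k₀ k₁ ε x) :
    ∃ C, ∀ t, |stiffWeight a b k₀ k₁ ε t| ≤ C := by
  obtain ⟨c, hc, h⟩ := h
  refine ⟨(√c)⁻¹, fun t => ?_⟩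
  by_cases ht : t ∈ Ioo a 0 ∪ Ioo 0 b
  · rw [stiffWeight, indicator_of_mem ht, abs_of_nonneg (by positivity)]
    exact inv_anti₀ (Real.sqrt_pos.2 hc) (Real.sqrt_le_sqrt (h t ht))
  · rw [stiffWeight, indicator_of_notMem ht, abs_zero]
    positivity

theorem matchesAtZero_of_eqOn {f F : ℝ → ℝ} (ha : a < 0) (hb : 0 < b) (hF : Continuous F)
    (h : ∀ x ∈ Ioo a 0 ∪ Ioo 0 b, f x = F x) : MatchesAtZero f := by
  refine ⟨F 0, ?_, ?_⟩
  · refine (hF.tendsto 0).mono_left nhdsWithin_le_nhds |>.congr' ?_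
    filter_upwards [Ioo_mem_nhdsLT ha] with x hx
    exact (h x (Or.inl hx)).symm
  · refine (hF.tendsto 0).mono_left nhdsWithin_le_nhds |>.congr' ?_
    filter_upwards [Ioo_mem_nhdsGT hb] with x hx
    exact (h x (Or.inr hx)).symm

/-- U, U', M and M' are continuous across 0, and M is the bending moment of U on both sides; this
yields all four transmission conditions. Integrating from a gives the conditions there, and the two
vanishing moments give those at b. For regularity, continuity of U makes M of class C² off 0, hence
U'' = M / k_ε is C² and U is C⁴. -/
theorem isStiffEigenvalue_of_integral_equation (ha : a < 0) (hb : 0 < b)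
    (hk₀ : ContDiffOn ℝ ∞ k₀ (Ioo a 0)) (hk₁ : ContDiffOn ℝ ∞ k₁ (Ioo 0 b))
    (hpos : ∀ x ∈ Ioo a 0 ∪ Ioo 0 b, 0 < stiffness k₀ k₁ ε x) {lam α β : ℝ} {U M : ℝ → ℝ}
    (hU0 : ¬ U =ᵐ[volume.restrict (Ioc a b)] 0) (hUi : IntegrableOn U (Ioc a b))
    (hMi : IntegrableOn (fun t => stiffWeight a b k₀ k₁ ε t ^ 2 * M t) (Ioc a b))
    (hM : ∀ t, M t = lam * doublePrimitive a b U t + α + β * t)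
    (hU : U = doublePrimitive a b (fun t => stiffWeight a b k₀ k₁ ε t ^ 2 * M t))
    (h0 : ∫ t in Ioc a b, stiffWeight a b k₀ k₁ ε t ^ 2 * M t = 0)
    (h1 : ∫ t in Ioc a b, t * (stiffWeight a b k₀ k₁ ε t ^ 2 * M t) = 0) :
    IsStiffEigenvalue a b k₀ k₁ ε lam := by
  set S := Ioo a 0 ∪ Ioo 0 b with hS
  set g : ℝ → ℝ := fun t => stiffWeight a b k₀ k₁ ε t ^ 2 * M t with hg
  have hSo : IsOpen S := isOpen_Ioo.union isOpen_Ioo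
  have hSab : ∀ x ∈ S, x ∈ Ioo a b := by
    rintro x (hx | hx)
    · exact ⟨hx.1, hx.2.trans hb⟩
    · exact ⟨ha.trans hx.1, hx.2⟩
  have hUd : ∀ x, HasDerivAt U (primitive a b g x) x := fun x => by
    rw [hU]; exact hasDerivAt_doublePrimitive hMi x
  have hUc : Continuous U := continuous_iff_continuousAt.2 fun x => (hUd x).continuousAt
  have hU' : deriv U = primitive a b g := funext fun x => (hUd x).deriv
  have hMd : ∀ x, HasDerivAt M (lam * primitive a b U x + β) x := fun x => by
    rw [show M = fun t => lam * doublePrimitive a b U t + α + β * t from funext hM]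
    exact ((((hasDerivAt_doublePrimitive hUi x).const_mul lam).add_const α).add
      ((hasDerivAt_id x).const_mul β)).congr_deriv (by simp)
  have hMc : Continuous M := continuous_iff_continuousAt.2 fun x => (hMd x).continuousAt
  have hM' : deriv M = fun x => lam * primitive a b U x + β := funext fun x => (hMd x).deriv
  have hM'' : ∀ x ∈ S, HasDerivAt (deriv M) (lam * U x) x := fun x hx => by
    rw [hM']
    exact ((hasDerivAt_primitive hUi (hSab x hx)
      (Eventually.of_forall fun y => hUc.continuousAt)).const_mul lam).add_const β
  have hgS : ∀ x ∈ S, g x = (stiffness k₀ k₁ ε x)⁻¹ * M x := fun x hx => by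
    rw [hg]; simp only; rw [stiffWeight_sq hx (hpos x hx)]
  have hst := contDiffOn_stiffness (ε := ε) hk₀ hk₁
  have hU1 : ContDiffOn ℝ 1 U S := by
    refine ContDiff.contDiffOn ?_
    rw [contDiff_one_iff_deriv, hU']
    exact ⟨fun x => (hUd x).differentiableAt, continuous_primitive hMi⟩
  have hM1 : ContDiffOn ℝ 1 (deriv M) S := by
    rw [show (1 : WithTop ℕ∞) = 0 + 1 from rfl, contDiffOn_succ_iff_deriv_of_isOpen hSo]
    refine ⟨fun x hx => (hM'' x hx).differentiableAt.differentiableWithinAt, by simp, ?_⟩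
    rw [contDiffOn_zero]
    exact (hUc.const_mul lam).continuousOn.congr fun x hx => (hM'' x hx).deriv
  have hM2 : ContDiffOn ℝ 2 M S := by
    rw [show (2 : WithTop ℕ∞) = 1 + 1 from rfl, contDiffOn_succ_iff_deriv_of_isOpen hSo]
    exact ⟨fun x _ => (hMd x).differentiableAt.differentiableWithinAt, by simp, hM1⟩
  have hg2 : ContDiffOn ℝ 2 g S :=
    (((contDiffOn_infty.1 hst 2).inv fun x hx => (hpos x hx).ne').mul hM2).congr hgS
  have hU'' : ∀ x ∈ S, HasDerivAt (deriv U) (g x) x := fun x hx => by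
    rw [hU']
    refine hasDerivAt_primitive hMi (hSab x hx) ?_
    filter_upwards [hSo.mem_nhds hx] with y hy
    exact hg2.continuousOn.continuousAt (hSo.mem_nhds hy)
  have hU3 : ContDiffOn ℝ 3 (deriv U) S := by
    rw [show (3 : WithTop ℕ∞) = 2 + 1 from rfl, contDiffOn_succ_iff_deriv_of_isOpen hSo]
    exact ⟨fun x hx => (hU'' x hx).differentiableAt.differentiableWithinAt, by simp,
      hg2.congr fun x hx => (hU'' x hx).deriv⟩
  have hmom : ∀ x ∈ S, moment k₀ k₁ ε U x = M x := fun x hx => by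
    rw [moment, (hU'' x hx).deriv, hgS x hx, mul_inv_cancel_left₀ (hpos x hx).ne']
  have hmom' : ∀ x ∈ S, deriv (moment k₀ k₁ ε U) x = deriv M x := fun x hx =>
    EventuallyEq.deriv_eq (by filter_upwards [hSo.mem_nhds hx] with y hy using hmom y hy)
  have hmom'' : ∀ x ∈ S, deriv (deriv (moment k₀ k₁ ε U)) x = deriv (deriv M) x := fun x hx =>
    EventuallyEq.deriv_eq (by filter_upwards [hSo.mem_nhds hx] with y hy using hmom' y hy)
  have hlim : ∀ {F : ℝ → ℝ} {x : ℝ} {s : Set ℝ}, Continuous F → F x = 0 →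
      Tendsto F (𝓝[s] x) (𝓝 0) := fun {F x s} hF hx => by
    have := (hF.tendsto x).mono_left (nhdsWithin_le_nhds (s := s))
    rwa [hx] at this
  have hpc : Continuous (deriv U) := by rw [hU']; exact continuous_primitive hMi
  have hM'c : Continuous (deriv M) := by
    rw [hM']; exact ((continuous_primitive hUi).const_mul lam).add continuous_const
  refine ⟨U, ⟨?_, ?_, ?_, ?_, ?_, ?_, ?_, ?_, ?_, ?_⟩, ?_⟩
  · rw [show (4 : WithTop ℕ∞) = 3 + 1 from rfl, contDiffOn_succ_iff_deriv_of_isOpen hSo]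
    exact ⟨fun x _ => (hUd x).differentiableAt.differentiableWithinAt, by simp, hU3⟩
  · intro x hx
    rw [hmom'' x hx, (hM'' x hx).deriv, sub_self]
  · refine hlim hUc ?_
    rw [hU, doublePrimitive_left]
  · refine hlim hpc ?_
    rw [hU', primitive_left]
  · refine hlim hUc ?_
    rw [hU, doublePrimitive_right hMi (integrableOn_id_mul hMi), h0, h1]
    ring
  · refine hlim hpc ?_
    rw [hU', primitive_right (ha.trans hb).le, h0]
  · exact matchesAtZero_of_eqOn ha hb hUc fun _ _ => rfl
  · exact matchesAtZero_of_eqOn ha hb hpc fun _ _ => rfl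
  · exact matchesAtZero_of_eqOn ha hb hMc hmom
  · exact matchesAtZero_of_eqOn ha hb hM'c hmom'
  -- The points 0 and b form a null set, so vanishing off them would contradict U ≠ 0 almost
  -- everywhere.
  · by_contra! hz
    refine hU0 ?_
    have h0b : ∀ c : ℝ, ∀ᵐ t ∂(volume.restrict (Ioc a b)), t ≠ c := fun c =>
      ae_restrict_of_ae (compl_mem_ae_iff.2 (measure_singleton c))
    filter_upwards [h0b 0, h0b b, ae_restrict_mem measurableSet_Ioc] with t ht0 htb ht
    refine hz t ?_
    rcases lt_or_gt_of_ne ht0 with h | h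
    · exact Or.inl ⟨ht.1, h⟩
    · exact Or.inr ⟨h, lt_of_le_of_ne ht.2 htb⟩

/-- An approximate solution of the eigenvalue problem compactly supported in `(0, b)` yields a
nearby eigenvalue. -/
theorem exists_isStiffEigenvalue_near (ha : a < 0) (hb : 0 < b)
    (hk₀ : ContDiffOn ℝ ∞ k₀ (Ioo a 0)) (hk₁ : ContDiffOn ℝ ∞ k₁ (Ioo 0 b))
    (hpos₀ : ∃ c > 0, ∀ x ∈ Ioo a 0, c ≤ k₀ x) (hpos₁ : ∃ c > 0, ∀ x ∈ Ioo 0 b, c ≤ k₁ x)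
    (hε : 0 < ε) {lam δ : ℝ} (hδ : 0 < δ) {w m : ℝ → ℝ}
    (hw : ContDiff ℝ 2 w) (hm : ContDiff ℝ 2 m)
    (hws : tsupport w ⊆ Ioo 0 b) (hms : tsupport m ⊆ Ioo 0 b)
    (hwm : ∀ t ∈ Ioo 0 b, m t = ε ^ 4 * k₁ t * deriv (deriv w) t)
    (happ : ∫ t in Ioc a b, (deriv (deriv m) t - lam * w t) ^ 2 < δ ^ 2 * ∫ t in Ioc a b, w t ^ 2) :
    ∃ lam', |lam' - lam| < δ ∧ IsStiffEigenvalue a b k₀ k₁ ε lam' := by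
  have hab := (ha.trans hb).le
  obtain ⟨c, hc, hcs⟩ := exists_pos_le_stiffness hε hpos₀ hpos₁
  have hpos : ∀ x ∈ Ioo a 0 ∪ Ioo 0 b, 0 < stiffness k₀ k₁ ε x := fun x hx => hc.trans_le (hcs x hx)
  have hr := measurable_stiffWeight
    (contDiffOn_stiffness (ε := ε) hk₀ hk₁).continuousOn hpos
  obtain ⟨C, hC⟩ := exists_bound_stiffWeight ⟨c, hc, hcs⟩
  obtain ⟨G, hGc, hGs, hG1, hG2⟩ := exists_green_operator hab hr hC
  have hz : ∀ {F : ℝ → ℝ}, tsupport F ⊆ Ioo 0 b → ∀ x ∉ Ioo 0 b, F x = 0 := fun hF x hx =>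
    image_eq_zero_of_notMem_tsupport fun h => hx (hF h)
  have hd : ∀ {F : ℝ → ℝ}, tsupport F ⊆ Ioo 0 b → tsupport (deriv F) ⊆ Ioo 0 b := fun hF =>
    tsupport_deriv_subset.trans hF
  have hm2c : Continuous (deriv (deriv m)) :=
    (contDiff_one_iff_deriv.1 ((contDiff_succ_iff_deriv (n := 1)).1 hm).2.2).2
  have hma : a ∉ Ioo 0 b := fun h => ha.not_gt h.1
  have hmb : b ∉ Ioo 0 b := fun h => h.2.false
  have hbd : ∀ {F : ℝ → ℝ}, Continuous F → MemLp F 2 (volume.restrict (Ioc a b)) := fun {F} hF => by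
    obtain ⟨C, hC⟩ := isCompact_Icc.exists_bound_of_continuousOn (hF.continuousOn (s := Icc a b))
    exact memLp_of_bound hF.measurable fun t ht => hC t (Ioc_subset_Icc_self ht)
  have hf := hbd hm2c
  -- With f = m'' this gives G f = w. Outside (0, b) both w and m vanish, so the weight there is
  -- irrelevant.
  have hGf := hG2 w m hw hm (hz hws a hma) (hz (hd hws) a hma) (hz hws b hmb) (hz (hd hws) b hmb)
    (hz hms a hma) (hz (hd hms) a hma) (hz hms b hmb) (hz (hd hms) b hmb) (fun t ht => by
      by_cases ht' : t ∈ Ioo 0 b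
      · rw [stiffWeight_sq (Or.inr ht') (hpos t (Or.inr ht')), hwm t ht', stiffness,
          if_neg (not_lt.2 ht'.1.le), inv_mul_cancel_left₀]
        have := hpos t (Or.inr ht')
        rw [stiffness, if_neg (not_lt.2 ht'.1.le)] at this
        exact this.ne'
      · rw [hz hms t ht', hz (hd (hd hws)) t ht', mul_zero]) hf.toLp hf.coeFn_toLp
  have hnorm : ∀ v : L2Interval a b, ‖v‖ ^ 2 = ∫ t in Ioc a b, v t ^ 2 := fun v => by
    rw [← real_inner_self_eq_norm_sq, L2.inner_def]
    exact integral_congr_ae (ae_of_all _ fun t => by simp [sq])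
  obtain ⟨μ, hμ, hμl, u, hu, hGu⟩ := exists_eigenvector_inv_near G hGc hGs hδ
    (lam := lam) (hf.toLp : L2Interval a b) (by
      refine lt_of_pow_lt_pow_left₀ 2 (by positivity) ?_
      rw [mul_pow, hnorm, hnorm]
      refine lt_of_eq_of_lt (integral_congr_ae ?_) (happ.trans_eq ?_)
      · filter_upwards [hf.coeFn_toLp, hGf, Lp.coeFn_smul lam (G hf.toLp),
          Lp.coeFn_sub hf.toLp (lam • G hf.toLp)] with t t1 t2 t3 t4
        rw [t4, Pi.sub_apply, t3, Pi.smul_apply, t1, t2, smul_eq_mul]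
      · congr 1
        refine integral_congr_ae ?_
        filter_upwards [hGf] with t ht
        rw [ht])
  obtain ⟨U, M, α, β, e1, e2, e3, e4, e5, e6, e7⟩ := hG1 μ u hμ hu hGu
  exact ⟨μ⁻¹, hμl, isStiffEigenvalue_of_integral_equation ha hb hk₀ hk₁ hpos e1 e2 e3 e4 e5 e6 e7⟩

end Stiff

/-! ### Semiclassical plane-wave quasimodes -/

/-- The plane wave `x ↦ exp (i ν x)`. -/
noncomputable def planeWave (ν x : ℝ) : ℂ := Complex.exp ((ν * x : ℝ) * Complex.I)

section PlaneWave

theorem norm_planeWave (ν x : ℝ) : ‖planeWave ν x‖ = 1 := Complex.norm_exp_ofReal_mul_I _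

theorem contDiff_planeWave (ν : ℝ) : ContDiff ℝ ∞ (planeWave ν) :=
  ((Complex.ofRealCLM.contDiff.comp (contDiff_const.mul contDiff_id)).mul contDiff_const).cexp

theorem hasDerivAt_planeWave (ν x : ℝ) :
    HasDerivAt (planeWave ν) (Complex.I * ν * planeWave ν x) x := by
  have h := ((((hasDerivAt_id x).const_mul ν).ofReal_comp).mul_const Complex.I).cexp
  refine h.congr_deriv ?_
  simp only [planeWave, id_eq]
  push_cast
  ring

theorem ContDiff.deriv_infty {F : Type*} [NormedAddCommGroup F] [NormedSpace ℝ F] {A : ℝ → F}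
    (hA : ContDiff ℝ ∞ A) : ContDiff ℝ ∞ (deriv A) := (contDiff_infty_iff_deriv.1 hA).2

theorem deriv_mul_planeWave {A : ℝ → ℂ} (hA : ContDiff ℝ ∞ A) (ν : ℝ) :
    deriv (fun x => A x * planeWave ν x) =
      fun x => (deriv A x + Complex.I * ν * A x) * planeWave ν x := by
  ext x
  refine (((hA.differentiable (by simp) x).hasDerivAt).mul
    (hasDerivAt_planeWave ν x)).deriv.trans ?_
  ring

/-- The semiclassical expansion of the second derivative of a modulated wave. -/
theorem deriv_deriv_mul_planeWave {A : ℝ → ℂ} (hA : ContDiff ℝ ∞ A) {ε : ℝ} (hε : ε ≠ 0)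
    (ξ x : ℝ) :
    (ε : ℂ) ^ 2 * deriv (deriv fun x => A x * planeWave (ξ / ε) x) x =
      (-(ξ : ℂ) ^ 2 * A x + ε * (ε * deriv (deriv A) x + 2 * Complex.I * ξ * deriv A x)) *
        planeWave (ξ / ε) x := by
  have hA1 : ContDiff ℝ ∞ fun x => deriv A x + Complex.I * (ξ / ε : ℝ) * A x :=
    hA.deriv_infty.add (contDiff_const.mul hA)
  rw [deriv_mul_planeWave hA, deriv_mul_planeWave hA1]
  have : deriv (fun x => deriv A x + Complex.I * (ξ / ε : ℝ) * A x) x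
      = deriv (deriv A) x + Complex.I * (ξ / ε : ℝ) * deriv A x :=
    (((hA.deriv_infty.differentiable (by simp) x).hasDerivAt).add
      ((hA.differentiable (by simp) x).hasDerivAt.const_mul _)).deriv
  simp only
  rw [this]
  have hε' : (ε : ℂ) ≠ 0 := by exact_mod_cast hε
  have hI : Complex.I ^ 2 = -1 := Complex.I_sq
  push_cast
  field_simp
  ring_nf
  rw [hI]
  ring

/-- A modulated wave of frequency `ξ / ε` approximately solves the equation with coefficient
`ε⁴ κ` and spectral parameter `ξ⁴ κ`. -/
theorem exists_bound_planeWave_quasimode {X κ : ℝ → ℂ} (hX : ContDiff ℝ ∞ X) (hκ : ContDiff ℝ ∞ κ)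
    (hXc : HasCompactSupport X) (ξ : ℝ) :
    ∃ R : ℝ, ∀ ε ∈ Ioo (0 : ℝ) 1, ∀ x,
      ‖deriv (deriv fun y => (ε : ℂ) ^ 4 * κ y *
          deriv (deriv fun z => X z * planeWave (ξ / ε) z) y) x
        - (ξ : ℂ) ^ 4 * κ x * X x * planeWave (ξ / ε) x‖ ≤ ε * R := by
  have hX1 := hX.deriv_infty
  have hX2 := hX1.deriv_infty
  -- These functions do not depend on ε, so bounds on their derivatives up to order two are uniform
  -- in ε.
  set f₀ : ℝ → ℂ := fun x => κ x * X x with hf₀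
  set f₁ : ℝ → ℂ := fun x => κ x * deriv X x with hf₁
  set f₂ : ℝ → ℂ := fun x => κ x * deriv (deriv X) x with hf₂
  have h₀ : ContDiff ℝ ∞ f₀ := hκ.mul hX
  have h₁ : ContDiff ℝ ∞ f₁ := hκ.mul hX1
  have h₂ : ContDiff ℝ ∞ f₂ := hκ.mul hX2
  have s₀ : HasCompactSupport f₀ := hXc.mul_left
  have s₁ : HasCompactSupport f₁ := hXc.deriv.mul_left
  have s₂ : HasCompactSupport f₂ := hXc.deriv.deriv.mul_left
  have hb : ∀ {f : ℝ → ℂ}, ContDiff ℝ ∞ f → HasCompactSupport f → ∃ C, ∀ x, ‖f x‖ ≤ C ∧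
      ‖deriv f x‖ ≤ C ∧ ‖deriv (deriv f) x‖ ≤ C := by
    intro f hf hs
    obtain ⟨C₀, hC₀⟩ := hf.continuous.bounded_above_of_compact_support hs
    obtain ⟨C₁, hC₁⟩ := hf.deriv_infty.continuous.bounded_above_of_compact_support hs.deriv
    obtain ⟨C₂, hC₂⟩ :=
      hf.deriv_infty.deriv_infty.continuous.bounded_above_of_compact_support hs.deriv.deriv
    exact ⟨max C₀ (max C₁ C₂), fun x => ⟨(hC₀ x).trans (by simp), (hC₁ x).trans (by simp),
      (hC₂ x).trans (by simp)⟩⟩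
  obtain ⟨C₀, hC₀⟩ := hb h₀ s₀
  obtain ⟨C₁, hC₁⟩ := hb h₁ s₁
  obtain ⟨C₂, hC₂⟩ := hb h₂ s₂
  set T := |ξ| ^ 2 * C₀ + C₂ + 2 * |ξ| * C₁ with hT
  refine ⟨|ξ| ^ 2 * (C₂ + 2 * |ξ| * C₁) + (T + 2 * |ξ| * T), fun ε hε x => ?_⟩
  have hε0 : ε ≠ 0 := hε.1.ne'
  -- B is the amplitude of ε²κ(X e)'', where e is the plane wave; a second use of the expansion, now
  -- on B e, gives the fourth-order operator.
  set B : ℝ → ℂ := fun x => -(ξ : ℂ) ^ 2 * f₀ x + ((ε : ℂ) ^ 2 * f₂ x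
    + 2 * Complex.I * ξ * ε * f₁ x) with hB
  have hBs : ContDiff ℝ ∞ B :=
    (contDiff_const.mul h₀).add ((contDiff_const.mul h₂).add (contDiff_const.mul h₁))
  have hm : (fun y => (ε : ℂ) ^ 4 * κ y * deriv (deriv fun z => X z * planeWave (ξ / ε) z) y)
      = fun y => (ε : ℂ) ^ 2 * (B y * planeWave (ξ / ε) y) := by
    ext y
    rw [show (ε : ℂ) ^ 4 * κ y * deriv (deriv fun z => X z * planeWave (ξ / ε) z) y
      = (ε : ℂ) ^ 2 * (κ y * ((ε : ℂ) ^ 2 *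
        deriv (deriv fun z => X z * planeWave (ξ / ε) z) y)) by ring,
      deriv_deriv_mul_planeWave hX hε0]
    simp only [hB, hf₀, hf₁, hf₂]
    ring
  have hm' : deriv (deriv fun y => (ε : ℂ) ^ 2 * (B y * planeWave (ξ / ε) y)) x
      = (ε : ℂ) ^ 2 * deriv (deriv fun y => B y * planeWave (ξ / ε) y) x := by
    rw [show deriv (fun y => (ε : ℂ) ^ 2 * (B y * planeWave (ξ / ε) y))
      = fun y => (ε : ℂ) ^ 2 * deriv (fun y => B y * planeWave (ξ / ε) y) y from
        funext fun y => deriv_const_mul_field _, deriv_const_mul_field]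
  have hlin : ∀ (g₀ g₁ g₂ : ℝ → ℂ), ContDiff ℝ ∞ g₀ → ContDiff ℝ ∞ g₁ → ContDiff ℝ ∞ g₂ →
      deriv (fun x => -(ξ : ℂ) ^ 2 * g₀ x + ((ε : ℂ) ^ 2 * g₂ x
        + 2 * Complex.I * ξ * ε * g₁ x)) = fun x => -(ξ : ℂ) ^ 2 * deriv g₀ x
        + ((ε : ℂ) ^ 2 * deriv g₂ x + 2 * Complex.I * ξ * ε * deriv g₁ x) := by
    intro g₀ g₁ g₂ k₀ k₁ k₂
    ext x
    exact (((k₀.differentiable (by simp) x).hasDerivAt.const_mul _).add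
      (((k₂.differentiable (by simp) x).hasDerivAt.const_mul _).add
      ((k₁.differentiable (by simp) x).hasDerivAt.const_mul _))).deriv
  have hest : ∀ z₀ z₁ z₂ : ℂ, ‖z₀‖ ≤ C₀ → ‖z₁‖ ≤ C₁ → ‖z₂‖ ≤ C₂ →
      ‖-(ξ : ℂ) ^ 2 * z₀ + ((ε : ℂ) ^ 2 * z₂ + 2 * Complex.I * ξ * ε * z₁)‖ ≤ T := by
    intro z₀ z₁ z₂ k₀ k₁ k₂
    refine (norm_add_le _ _).trans ?_
    refine (add_le_add le_rfl (norm_add_le _ _)).trans ?_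
    simp only [norm_mul, norm_neg, norm_pow, Complex.norm_real, Complex.norm_I, Real.norm_eq_abs,
      Complex.norm_ofNat, mul_one, abs_of_pos hε.1]
    have e1 : ε ^ 2 * ‖z₂‖ ≤ 1 * C₂ :=
      mul_le_mul (pow_le_one₀ hε.1.le hε.2.le) k₂ (norm_nonneg _) zero_le_one
    have e2 : 2 * |ξ| * ε * ‖z₁‖ ≤ 2 * |ξ| * 1 * C₁ :=
      mul_le_mul (mul_le_mul_of_nonneg_left hε.2.le (by positivity)) k₁ (norm_nonneg _)
        (by positivity)
    have e3 : |ξ| ^ 2 * ‖z₀‖ ≤ |ξ| ^ 2 * C₀ := mul_le_mul_of_nonneg_left k₀ (by positivity)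
    rw [hT]
    linarith
  have hB1 : ‖deriv B x‖ ≤ T := by
    rw [hB, hlin _ _ _ h₀ h₁ h₂]
    exact hest _ _ _ (hC₀ x).2.1 (hC₁ x).2.1 (hC₂ x).2.1
  have hB2 : ‖deriv (deriv B) x‖ ≤ T := by
    rw [hB, hlin _ _ _ h₀ h₁ h₂, hlin _ _ _ h₀.deriv_infty h₁.deriv_infty h₂.deriv_infty]
    exact hest _ _ _ (hC₀ x).2.2 (hC₁ x).2.2 (hC₂ x).2.2
  rw [hm, hm', deriv_deriv_mul_planeWave hBs hε0, ← sub_mul, norm_mul, norm_planeWave, mul_one]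
  -- The leading terms cancel because (-ξ²)² = ξ⁴, and a factor ε comes out of everything left.
  have hexp : -(ξ : ℂ) ^ 2 * B x + ε * (ε * deriv (deriv B) x + 2 * Complex.I * ξ * deriv B x)
      - (ξ : ℂ) ^ 4 * κ x * X x = ε * (-(ξ : ℂ) ^ 2 * (ε * f₂ x + 2 * Complex.I * ξ * f₁ x)
        + (ε * deriv (deriv B) x + 2 * Complex.I * ξ * deriv B x)) := by
    simp only [hB, hf₀]
    ring
  have hest' : ∀ (z₁ z₂ : ℂ) (D₁ D₂ : ℝ), ‖z₁‖ ≤ D₁ → ‖z₂‖ ≤ D₂ →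
      ‖(ε : ℂ) * z₂ + 2 * Complex.I * ξ * z₁‖ ≤ D₂ + 2 * |ξ| * D₁ := by
    intro z₁ z₂ D₁ D₂ k₁ k₂
    refine (norm_add_le _ _).trans ?_
    simp only [norm_mul, Complex.norm_real, Complex.norm_I, Real.norm_eq_abs,
      Complex.norm_ofNat, mul_one, abs_of_pos hε.1]
    refine add_le_add ?_ (mul_le_mul_of_nonneg_left k₁ (by positivity))
    exact (mul_le_of_le_one_left (norm_nonneg _) hε.2.le).trans k₂
  rw [hexp, norm_mul, Complex.norm_real, Real.norm_of_nonneg hε.1.le]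
  refine mul_le_mul_of_nonneg_left ((norm_add_le _ _).trans (add_le_add ?_ ?_)) hε.1.le
  · rw [norm_mul, norm_neg, norm_pow, Complex.norm_real, Real.norm_eq_abs]
    exact mul_le_mul_of_nonneg_left (hest' _ _ _ _ (hC₁ x).1 (hC₂ x).1) (by positivity)
  · exact hest' _ _ _ _ hB1 hB2

end PlaneWave

/-! ### Localization near a point and passage to real functions -/

section Main

open MeasureTheory

variable {a b : ℝ} {k₀ k₁ : ℝ → ℝ}

theorem deriv_realFunctional_comp {F : ℝ → ℂ} (hF : ContDiff ℝ ∞ F) (L : ℂ →L[ℝ] ℝ) :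
    deriv (fun x => L (F x)) = fun x => L (deriv F x) :=
  funext fun x => (L.hasFDerivAt.comp_hasDerivAt x
    (hF.differentiable (by simp) x).hasDerivAt).deriv

/-- Outside s the bump vanishes in a neighbourhood of the point, so the behaviour of k at the
boundary of s does not matter. -/
theorem contDiff_bump_mul {c : ℝ} (χ : ContDiffBump c) {k : ℝ → ℝ} {s : Set ℝ} (hs : IsOpen s)
    (hk : ContDiffOn ℝ ∞ k s) (hχ : Metric.closedBall c χ.rOut ⊆ s) :
    ContDiff ℝ ∞ fun x => χ x * k x := by
  rw [contDiff_iff_contDiffAt]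
  intro x
  by_cases hx : x ∈ s
  · exact χ.contDiffAt.mul (hk.contDiffAt (hs.mem_nhds hx))
  · have hx' : x ∉ tsupport χ := fun h => hx (hχ (χ.tsupport_eq ▸ h))
    refine (contDiffAt_const (c := (0 : ℝ))).congr_of_eventuallyEq ?_
    filter_upwards [notMem_tsupport_iff_eventuallyEq.1 hx'] with y hy
    rw [hy, Pi.zero_apply, zero_mul]

/-- Eigenvalues for small `ε` come arbitrarily close to any positive number. -/
theorem exists_isStiffEigenvalue_near_of_pos (ha : a < 0) (hb : 0 < b)
    (hk₀ : ContDiffOn ℝ ∞ k₀ (Ioo a 0)) (hk₁ : ContDiffOn ℝ ∞ k₁ (Ioo 0 b))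
    (hpos₀ : ∃ c > 0, ∀ x ∈ Ioo a 0, c ≤ k₀ x) (hpos₁ : ∃ c > 0, ∀ x ∈ Ioo 0 b, c ≤ k₁ x)
    {lam δ η : ℝ} (hlam : 0 < lam) (hδ : 0 < δ) (hη : 0 < η) :
    ∃ ε ∈ Ioo (0 : ℝ) 1, ε < η ∧ ∃ lam', |lam' - lam| < δ ∧
      IsStiffEigenvalue a b k₀ k₁ ε lam' := by
  set x₀ := b / 2 with hx₀
  have hx₀m : x₀ ∈ Ioo 0 b := ⟨by positivity, by rw [hx₀]; linarith⟩
  have hk₁x₀ : 0 < k₁ x₀ := by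
    obtain ⟨c, hc, h⟩ := hpos₁
    exact hc.trans_le (h _ hx₀m)
  -- The frequency is chosen so that the symbol frozen at x₀ equals lam.
  obtain ⟨ξ, hξ⟩ : ∃ ξ : ℝ, k₁ x₀ * ξ ^ 4 = lam := by
    refine ⟨(lam / k₁ x₀) ^ ((4 : ℕ) : ℝ)⁻¹, ?_⟩
    rw [Real.rpow_inv_natCast_pow (by positivity) (by norm_num), mul_div_cancel₀ _ hk₁x₀.ne']
  obtain ⟨h, hh, hball⟩ : ∃ h > 0, ∀ x ∈ Metric.ball x₀ h, x ∈ Ioo 0 b ∧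
      |ξ ^ 4 * k₁ x - lam| < δ / 2 := by
    have hc : ContinuousAt (fun x => ξ ^ 4 * k₁ x - lam) x₀ :=
      ((hk₁.continuousOn.continuousAt (isOpen_Ioo.mem_nhds hx₀m)).const_mul _).sub_const _
    have h0 : ξ ^ 4 * k₁ x₀ - lam = 0 := by rw [← hξ]; ring
    have hc' : Tendsto (fun x => |ξ ^ 4 * k₁ x - lam|) (𝓝 x₀) (𝓝 0) := by
      have := hc.abs.tendsto
      rwa [h0, abs_zero] at this
    have hm : ∀ᶠ x in 𝓝 x₀, x ∈ Ioo 0 b := Ioo_mem_nhds hx₀m.1 hx₀m.2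
    exact Metric.eventually_nhds_iff_ball.1
      (hm.and (hc'.eventually (gt_mem_nhds (half_pos hδ))))
  let χ : ContDiffBump x₀ := ⟨h / 8, h / 4, by positivity, by linarith⟩
  -- The wider bump equals 1 on the support of χ: it makes k₁ globally smooth without changing it
  -- where the quasimode lives.
  let χ₁ : ContDiffBump x₀ := ⟨h / 4, h / 2, by positivity, by linarith⟩
  have hsupp : tsupport χ ⊆ Metric.closedBall x₀ (h / 4) := χ.tsupport_eq.le
  have hcb : Metric.closedBall x₀ (h / 2) ⊆ Metric.ball x₀ h :=
    Metric.closedBall_subset_ball (by linarith)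
  have hcb' : Metric.closedBall x₀ (h / 4) ⊆ Ioo 0 b := fun x hx =>
    (hball x (hcb (Metric.closedBall_subset_closedBall (by linarith) hx))).1
  set X : ℝ → ℂ := fun x => (χ x : ℂ) with hX
  set κ : ℝ → ℂ := fun x => ((χ₁ x * k₁ x : ℝ) : ℂ) with hκ
  have hXs : ContDiff ℝ ∞ X := Complex.ofRealCLM.contDiff.comp χ.contDiff
  have hκs : ContDiff ℝ ∞ κ := Complex.ofRealCLM.contDiff.comp
    (contDiff_bump_mul χ₁ isOpen_Ioo hk₁ fun x hx => (hball x (hcb hx)).1)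
  have hXt : tsupport X ⊆ tsupport χ := tsupport_comp_subset Complex.ofReal_zero _
  have hXc : HasCompactSupport X := χ.hasCompactSupport.comp_left Complex.ofReal_zero
  obtain ⟨R, hR⟩ := exists_bound_planeWave_quasimode hXs hκs hXc ξ
  have hI : 0 < ∫ x in Ioc a b, χ x ^ 2 := by
    rw [setIntegral_eq_integral_of_forall_compl_eq_zero]
    · refine Continuous.integral_pos_of_hasCompactSupport_nonneg_nonzero (x := x₀)
        (χ.continuous.pow 2) (χ.hasCompactSupport.comp_left (g := fun y : ℝ => y ^ 2) (by simp))
        (fun x => sq_nonneg _) ?_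
      rw [χ.one_of_mem_closedBall (Metric.mem_closedBall_self χ.rIn_pos.le)]
      norm_num
    · intro x hx
      rw [image_eq_zero_of_notMem_tsupport (f := χ), zero_pow (by norm_num)]
      exact fun hx' => hx ⟨ha.trans (hcb' (hsupp hx')).1, (hcb' (hsupp hx')).2.le⟩
  set I := ∫ x in Ioc a b, χ x ^ 2 with hIdef
  -- Freezing the coefficient costs δ²/2 · I of the budget δ² · I; ε is taken small enough for the
  -- wave remainder to fit strictly into the other half.
  obtain ⟨ε, hεη, hε1, hεR, hε0⟩ : ∃ ε : ℝ, ε < η ∧ ε < 1 ∧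
      2 * (ε * R) ^ 2 * (b - a) < δ ^ 2 / 2 * I ∧ 0 < ε := by
    have ht : Tendsto (fun ε : ℝ => 2 * (ε * R) ^ 2 * (b - a)) (𝓝[>] 0) (𝓝 0) := by
      have : Continuous fun ε : ℝ => 2 * (ε * R) ^ 2 * (b - a) := by fun_prop
      have := (this.tendsto 0).mono_left (nhdsWithin_le_nhds (s := Ioi 0))
      simpa using this
    have e1 : ∀ᶠ ε : ℝ in 𝓝[>] 0, ε < η := nhdsWithin_le_nhds (gt_mem_nhds hη)
    have e2 : ∀ᶠ ε : ℝ in 𝓝[>] 0, ε < 1 := nhdsWithin_le_nhds (gt_mem_nhds one_pos)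
    have e3 : ∀ᶠ ε : ℝ in 𝓝[>] 0, 0 < ε := self_mem_nhdsWithin
    exact (e1.and (e2.and ((ht.eventually (gt_mem_nhds (by positivity))).and e3))).exists
  have hε : ε ∈ Ioo (0 : ℝ) 1 := ⟨hε0, hε1⟩
  refine ⟨ε, hε, hεη, ?_⟩
  set F : ℝ → ℂ := fun x => X x * planeWave (ξ / ε) x with hF
  set m : ℝ → ℂ := fun x => (ε : ℂ) ^ 4 * κ x * deriv (deriv F) x with hm
  have hFs : ContDiff ℝ ∞ F := hXs.mul (contDiff_planeWave _)
  have hms : ContDiff ℝ ∞ m := (contDiff_const.mul hκs).mul hFs.deriv_infty.deriv_infty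
  have hFt : tsupport F ⊆ tsupport X := tsupport_mul_subset_left
  have hF2t : tsupport (deriv (deriv F)) ⊆ tsupport F :=
    tsupport_deriv_subset.trans tsupport_deriv_subset
  have hmt : tsupport m ⊆ tsupport F := tsupport_mul_subset_right.trans hF2t
  have hF0 : tsupport F ⊆ Metric.closedBall x₀ (h / 4) := hFt.trans (hXt.trans hsupp)
  -- The complex wave has modulus one, so the L² norm of F does not depend on ε and no oscillating
  -- integral needs estimating.
  have hFn : ∀ x, ‖F x‖ ^ 2 = χ x ^ 2 := fun x => by
    rw [hF, norm_mul, norm_planeWave, mul_one, hX, Complex.norm_real, Real.norm_eq_abs, sq_abs]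
  have hκ1 : ∀ x ∈ Metric.closedBall x₀ (h / 4), κ x = k₁ x := fun x hx => by
    simp only [hκ]
    rw [χ₁.one_of_mem_closedBall hx, one_mul]
  have hpt : ∀ x, ‖deriv (deriv m) x - lam * F x‖ ^ 2 ≤
      δ ^ 2 / 2 * χ x ^ 2 + 2 * (ε * R) ^ 2 := by
    intro x
    have h1 : ‖deriv (deriv m) x - lam * F x‖ ≤ ε * R + δ / 2 * χ x := by
      have e : deriv (deriv m) x - lam * F x = (deriv (deriv m) x -
          (ξ : ℂ) ^ 4 * κ x * X x * planeWave (ξ / ε) x) +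
          ((ξ : ℂ) ^ 4 * κ x - lam) * X x * planeWave (ξ / ε) x := by
        simp only [hF]; ring
      rw [e]
      refine (norm_add_le _ _).trans (add_le_add (hR ε hε x) ?_)
      rw [norm_mul, norm_mul, norm_planeWave, mul_one, hX, Complex.norm_real,
        Real.norm_of_nonneg χ.nonneg]
      by_cases hx : x ∈ Metric.closedBall x₀ (h / 4)
      · refine mul_le_mul_of_nonneg_right ?_ χ.nonneg
        rw [hκ1 x hx]
        have := (hball x (hcb (Metric.closedBall_subset_closedBall (by linarith) hx))).2.le
        rw [← Real.norm_eq_abs, ← Complex.norm_real] at this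
        push_cast at this
        exact this
      · rw [image_eq_zero_of_notMem_tsupport fun h => hx (hsupp h)]
        simp
    -- This uses (p + q)² ≤ 2p² + 2q² with q = (δ/2)χ, whence the factor δ²/2.
    have h2 := pow_le_pow_left₀ (norm_nonneg _) h1 2
    nlinarith [sq_nonneg (ε * R - δ / 2 * χ x)]
  have hm2c : Continuous (deriv (deriv m)) := hms.deriv_infty.deriv_infty.continuous
  have hmain : ∫ x in Ioc a b, ‖deriv (deriv m) x - lam * F x‖ ^ 2
      < δ ^ 2 * ∫ x in Ioc a b, ‖F x‖ ^ 2 := by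
    have hFc := hFs.continuous
    have hχc := χ.continuous
    have i1 : IntegrableOn (fun x => δ ^ 2 / 2 * χ x ^ 2) (Ioc a b) :=
      (by fun_prop : Continuous fun x => δ ^ 2 / 2 * χ x ^ 2).integrableOn_Ioc
    have i2 : IntegrableOn (fun _ : ℝ => 2 * (ε * R) ^ 2) (Ioc a b) :=
      continuous_const.integrableOn_Ioc
    calc ∫ x in Ioc a b, ‖deriv (deriv m) x - lam * F x‖ ^ 2
        ≤ ∫ x in Ioc a b, (δ ^ 2 / 2 * χ x ^ 2 + 2 * (ε * R) ^ 2) :=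
          integral_mono (by fun_prop : Continuous fun x =>
            ‖deriv (deriv m) x - lam * F x‖ ^ 2).integrableOn_Ioc (Integrable.add i1 i2) hpt
      _ = δ ^ 2 / 2 * I + 2 * (ε * R) ^ 2 * (b - a) := by
          rw [integral_add i1 i2, integral_const_mul, setIntegral_const]
          simp [(ha.trans hb).le, mul_comm, hIdef]
      _ < δ ^ 2 * I := by linarith
      _ = δ ^ 2 * ∫ x in Ioc a b, ‖F x‖ ^ 2 := by simp_rw [hFn, hIdef]
  -- The coefficients are real, so a real-linear functional of the complex quasimode is again a
  -- candidate quasimode. The squared norms are the sums of those of the real and imaginary parts,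
  -- so at least one part satisfies the strict inequality.
  have key : ∀ L : ℂ →L[ℝ] ℝ, ∫ x in Ioc a b, L (deriv (deriv m) x - lam * F x) ^ 2
      < δ ^ 2 * ∫ x in Ioc a b, L (F x) ^ 2 →
      ∃ lam', |lam' - lam| < δ ∧ IsStiffEigenvalue a b k₀ k₁ ε lam' := by
    intro L hL
    have hLF : deriv (deriv fun x => L (F x)) = fun x => L (deriv (deriv F) x) := by
      rw [deriv_realFunctional_comp hFs, deriv_realFunctional_comp hFs.deriv_infty]
    have hLm : deriv (deriv fun x => L (m x)) = fun x => L (deriv (deriv m) x) := by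
      rw [deriv_realFunctional_comp hms, deriv_realFunctional_comp hms.deriv_infty]
    refine exists_isStiffEigenvalue_near ha hb hk₀ hk₁ hpos₀ hpos₁ hε0 hδ
      (w := fun x => L (F x)) (m := fun x => L (m x))
      (contDiff_infty.1 (L.contDiff.comp hFs) 2) (contDiff_infty.1 (L.contDiff.comp hms) 2)
      ((tsupport_comp_subset (map_zero L) F).trans (hF0.trans hcb'))
      ((tsupport_comp_subset (map_zero L) m).trans (hmt.trans (hF0.trans hcb'))) ?_ ?_
    · intro t _
      rw [hLF]
      simp only [hm]
      by_cases ht : t ∈ Metric.closedBall x₀ (h / 4)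
      · rw [hκ1 t ht, ← smul_eq_mul (ε ^ 4 * k₁ t), ← map_smul, Complex.real_smul]
        push_cast
        rfl
      · rw [image_eq_zero_of_notMem_tsupport fun h => ht (hF0 (hF2t h))]
        simp
    · rw [hLm]
      refine lt_of_eq_of_lt (integral_congr_ae (ae_of_all _ fun t => ?_)) hL
      simp only
      rw [← Complex.real_smul, map_sub, map_smul, smul_eq_mul]
  have hsplit : ∀ {Z : ℝ → ℂ}, Continuous Z → ∫ x in Ioc a b, ‖Z x‖ ^ 2 =
      (∫ x in Ioc a b, Complex.reCLM (Z x) ^ 2) + ∫ x in Ioc a b, Complex.imCLM (Z x) ^ 2 := by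
    intro Z hZ
    rw [← integral_add
      (by fun_prop : Continuous fun x => Complex.reCLM (Z x) ^ 2).integrableOn_Ioc
      (by fun_prop : Continuous fun x => Complex.imCLM (Z x) ^ 2).integrableOn_Ioc]
    refine integral_congr_ae (ae_of_all _ fun x => ?_)
    simp only [Complex.reCLM_apply, Complex.imCLM_apply]
    rw [Complex.sq_norm, Complex.normSq_apply]
    ring
  rw [hsplit (Z := fun x => deriv (deriv m) x - lam * F x)
    (hm2c.sub (continuous_const.mul hFs.continuous)), hsplit hFs.continuous,
    mul_add] at hmain
  by_contra hno
  have n1 := not_lt.1 fun h => hno (key Complex.reCLM h)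
  have n2 := not_lt.1 fun h => hno (key Complex.imCLM h)
  exact absurd hmain (not_lt.2 (add_le_add n1 n2))

end Main

/-! ### Sequences of eigenvalues and the closure -/

theorem lemma3p1 (a b : ℝ) (ha : a < 0) (hb : 0 < b) (k₀ k₁ : ℝ → ℝ)
    (hk₀ : ContDiffOn ℝ ∞ k₀ (Ioo a 0)) (hk₁ : ContDiffOn ℝ ∞ k₁ (Ioo 0 b))
    (hpos₀ : ∃ c > 0, ∀ x ∈ Ioo a 0, c ≤ k₀ x)
    (hpos₁ : ∃ c > 0, ∀ x ∈ Ioo 0 b, c ≤ k₁ x) :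
    {p : ℝ × ℝ | p.1 = 0 ∧ 0 ≤ p.2} ⊆ closure (stiffSpectrumSet a b k₀ k₁) ∧
    ∀ lam : ℝ, 0 < lam → ∃ (ε μ : ℕ → ℝ),
      (∀ n, ε n ∈ Ioo (0 : ℝ) 1 ∧ IsStiffEigenvalue a b k₀ k₁ (ε n) (μ n)) ∧
      Tendsto ε atTop (𝓝 0) ∧ Tendsto μ atTop (𝓝 lam) := by
  have hseq : ∀ lam : ℝ, 0 < lam → ∃ (ε μ : ℕ → ℝ),
      (∀ n, ε n ∈ Ioo (0 : ℝ) 1 ∧ IsStiffEigenvalue a b k₀ k₁ (ε n) (μ n)) ∧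
      Tendsto ε atTop (𝓝 0) ∧ Tendsto μ atTop (𝓝 lam) := by
    intro lam hlam
    have h : ∀ n : ℕ, ∃ ε μ : ℝ, (ε ∈ Ioo (0 : ℝ) 1 ∧ IsStiffEigenvalue a b k₀ k₁ ε μ) ∧
        ε ≤ 1 / ((n : ℝ) + 1) ∧ dist μ lam ≤ 1 / ((n : ℝ) + 1) := fun n => by
      obtain ⟨ε, hε, hε', μ, hμ, he⟩ := exists_isStiffEigenvalue_near_of_pos ha hb hk₀ hk₁ hpos₀
        hpos₁ hlam (Nat.one_div_pos_of_nat (α := ℝ) (n := n)) (Nat.one_div_pos_of_nat (n := n))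
      exact ⟨ε, μ, ⟨hε, he⟩, hε'.le, hμ.le⟩
    choose ε μ h1 h2 h3 using h
    exact ⟨ε, μ, h1, squeeze_zero (fun n => (h1 n).1.1.le) h2 tendsto_one_div_add_atTop_nhds_zero_nat,
      tendsto_iff_dist_tendsto_zero.2
        (squeeze_zero (fun _ => dist_nonneg) h3 tendsto_one_div_add_atTop_nhds_zero_nat)⟩
  refine ⟨?_, hseq⟩
  have hpos : ∀ lam : ℝ, 0 < lam → ((0 : ℝ), lam) ∈ closure (stiffSpectrumSet a b k₀ k₁) := by
    intro lam hlam
    obtain ⟨ε, μ, h1, h2, h3⟩ := hseq lam hlam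
    exact mem_closure_of_tendsto (h2.prodMk_nhds h3) (Eventually.of_forall h1)
  rintro ⟨p, lam⟩ ⟨hp, hlam⟩
  obtain rfl : p = 0 := hp
  -- Shifting lam by 1/(n+1) also covers the endpoint lam = 0, as the closure is closed.
  have ht : Tendsto (fun n : ℕ => ((0 : ℝ), lam + 1 / ((n : ℝ) + 1))) atTop (𝓝 (0, lam)) := by
    refine tendsto_const_nhds.prodMk_nhds ?_
    simpa using (tendsto_const_nhds (x := lam)).add (tendsto_one_div_add_atTop_nhds_zero_nat (𝕜 := ℝ))
  refine isClosed_closure.mem_of_tendsto ht (Eventually.of_forall fun n => hpos _ ?_)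
  exact add_pos_of_nonneg_of_pos hlam Nat.one_div_pos_of_nat
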